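/- **Setting.** Let $m\ge 3$, $d\in\mathbb N_0$, and let $\mathcal X=[0,\pi]^{m-2}\times[-\pi,\pi]$ be the space of angles $(\theta,\phi)=(\theta_1,\dots,\theta_{m-2},\phi)$ of the unit sphere in $\mathbb R^m$. For integers $\lambda=\mu_0\ge\mu_1\ge\dots\ge\mu_{m-3}\ge|\mu_{m-2}|$ (with $\mu_{m-2}\in\mathbb Z$) the real hyperspherical harmonic of level $\lambda$ is $$Y_{\mu}(\theta,\phi)=\prod_{i=1}^{m-3}\Big[\tilde\gamma_i\,C^{\mu_i+\frac{m-i-1}{2}}_{\mu_{i-1}-\mu_i}(\cos\theta_i)(\sin\theta_i)^{\mu_i}\Big]\;B\;P^{|\mu_{m-2}|}_{\mu_{m-3}}(\cos\theta_{m-2})\,\tau_{\mu_{m-2}}(\phi),$$ where $C_k^\alpha$ are the Gegenbauer polynomials; $P_l^k(\cos\theta)=(-1)^k\frac{(2k)!}{2^kk!}(\sin\theta)^kC_{l-k}^{k+1/2}(\cos\theta)$; $\tau_k(\phi)=\cos(k\phi)$ for $k>0$, $\sin(|k|\phi)$ for $k<0$, and $1/\sqrt2$ for $k=0$; $$\tilde\gamma_i=\Big[\tfrac{2^{2\mu_i+m-i-3}(\mu_{i-1}-\mu_i)!\,(2\mu_{i-1}+m-i-1)\,\Gamma(\mu_i+\frac{m-i-1}2)^2}{\pi(\mu_{i-1}+\mu_i+m-i-2)!}\Big]^{1/2},\qquad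 B=\Big[\tfrac{2(2\mu_{m-3}+1)(\mu_{m-3}-|\mu_{m-2}|)!}{4\pi(\mu_{m-3}+|\mu_{m-2}|)!}\Big]^{1/2}.$$ Let $f_d$ be the vector of all $D$ harmonics of levels $0,\dots,d$. A design is a probability measure $\xi$ on $\mathcal X$, with information matrix $M(\xi)=\int f_df_d^T\,d\xi$. Let $0\le k_0<\dots<k_q\le d$, and let $K$ be the $0$–$1$ matrix with $D$ rows for which $K^T\mathbf c$ consists of the coefficients of the harmonics of levels $k_0,\dots,k_q$: its transpose is made of blocks $K_{j,l}$ ($0\le j\le q$, $0\le l\le d$) with $K_{j,l}=I$ if $l=k_j$ and $K_{j,l}=0$ otherwise. Put $$s(k)=\frac{(m+2k-2)(k+m-3)!}{k!\,(m-2)!},\qquad s=\sum_{j=0}^q s(k_j).$$ For a design $\xi$ with $\operatorname{range}K\subset\operatorname{range}M(\xi)$ let $C_K(\xi)=(K^TM(\xi)^-K)^{-1}$ with any generalized inverse $M(\xi)^-$, and let $\Phi_p(\xi)=(\operatorname{tr}C_K(\xi)^p)^{1/p}$ for real $p<1$, $p\ne0$, with $\Phi_0(\xi)=(\det C_K(\xi))^{1/s}$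 and $\Phi_{-\infty}(\xi)=\lambda_{\min}(C_K(\xi))$. A design is $\Phi_p$-optimal for $K^T\mathbf c$ if it satisfies the range inclusion and maximises $\Phi_p$ among all designs that satisfy it; it is $\Phi_{E_s}$-optimal if it maximises, among all designs, the sum of the $s$ smallest eigenvalues (with multiplicity) of $M(\xi)$. **Theorem.** Let $t\ge 2d+1$, $r\in\{d+1,\dots,2d\}$ and $\beta\in(-\frac{t+1}{t}\pi,-\pi]$. For $i=1,\dots,m-2$ let $-1\le x^i_1<\dots<x^i_r\le1$ and $\omega^i_1,\dots,\omega^i_r>0$ with $\sum_j\omega^i_j=1$ form a quadrature formula of degree $2d$ for $a_i(x)=(1-x^2)^{(m-i-2)/2}$, that is, $$\int_{-1}^1a_i(x)x^\ell\,dx=\Big(\int_{-1}^1a_i(x)\,dx\Big)\sum_{j=1}^r\omega^i_j(x^i_j)^\ell,\qquad \ell=0,\dots,2d.$$ Let $\zeta_i$ be the design with masses $\omega^i_j$ at $\arccos x^i_j$, and let $\nu$ be the design with masses $1/t$ at $\beta+2\pi j/t$, $j=1,\dots,t$. Then $\xi=\zeta_1\otimes\dots\otimes\zeta_{m-2}\otimes\nu$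 has information matrix $$M(\xi)=\frac1{\tilde\Omega}I_D,\qquad \tilde\Omega=\int_{\mathcal X}\prod_{i=1}^{m-2}(\sin\theta_i)^{m-i-1}\,d\theta\,d\phi .$$ It is $\Phi_p$-optimal for $K^T\mathbf c$ for every $p\in[-\infty,1)$. Moreover, $K$ has exactly $s$ columns, and $\xi$ is $\Phi_{E_s}$-optimal. -/

import Mathlib

/-!
# Optimal designs for regression with real hyperspherical harmonics

The sphere is the unit sphere of `ℝ^m` with `m = n + 3` (so `n : ℕ` covers exactly the dimensions
`m ≥ 3`).  It is parametrised by the `m - 2 = n + 1` polar angles `θ_1, …, θ_{m-2} ∈ [0, π]`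
and the azimuth `φ ∈ [-π, π]`.  A polar angle `θ_i` (`1 ≤ i ≤ m - 2`) is `x.1 j` with
`j : Fin (n + 1)`, `i = j + 1`; the azimuth is `x.2`.
-/

noncomputable section

namespace HypersphericalDesign

open MeasureTheory Matrix

/-! ## Approximate design theory for a linear regression model -/

section General

variable {X ι κ : Type*} [MeasurableSpace X]

/-- An approximate design on the design space `S`: a probability measure carried by `S`. -/
structure IsDesign (S : Set X) (ξ : Measure X) : Prop where
  isProbabilityMeasure : IsProbabilityMeasure ξ
  ae_mem : ∀ᵐ x ∂ξ, x ∈ S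

/-- The information matrix `M(ξ) = ∫ f(x) f(x)ᵀ dξ(x)` for the vector `f` of regression
functions. -/
def infoMatrix (f : ι → X → ℝ) (ξ : Measure X) : Matrix ι ι ℝ :=
  Matrix.of fun a b => ∫ x, f a x * f b x ∂ξ

theorem infoMatrix_isHermitian (f : ι → X → ℝ) (ξ : Measure X) :
    (infoMatrix f ξ).IsHermitian := by
  ext a b
  simp [infoMatrix, mul_comm]

variable [Fintype ι] [Fintype κ] [DecidableEq ι] [DecidableEq κ]

/-- Every real square matrix has a generalized inverse. -/
theorem exists_generalizedInverse (M : Matrix ι ι ℝ) : ∃ G : Matrix ι ι ℝ, M * G * M = M := by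
  obtain ⟨h, hh⟩ := LinearMap.exists_rightInverse_of_surjective
    (LinearMap.rangeRestrict (Matrix.toLin' M)) (LinearMap.range_rangeRestrict _)
  obtain ⟨g, hg⟩ := LinearMap.exists_extend h
  refine ⟨LinearMap.toMatrix' g, ?_⟩
  apply Matrix.toLin'.injective
  rw [Matrix.toLin'_mul, Matrix.toLin'_mul, Matrix.toLin'_toMatrix']
  refine LinearMap.pi_ext' fun v => ?_
  have h1 : g (Matrix.toLin' M (Pi.single v 1)) =
      h (LinearMap.rangeRestrict (Matrix.toLin' M) (Pi.single v 1)) := by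
    rw [← hg]; rfl
  have h2 := congrArg Subtype.val
    (LinearMap.congr_fun hh (LinearMap.rangeRestrict (Matrix.toLin' M) (Pi.single v 1)))
  ext1
  simp only [LinearMap.comp_apply, LinearMap.coe_single]
  rw [h1]
  exact h2

/-- A generalized inverse `M⁻`, that is, a matrix with `M M⁻ M = M`. -/
def generalizedInverse (M : Matrix ι ι ℝ) : Matrix ι ι ℝ :=
  Classical.choose (exists_generalizedInverse M)

theorem mul_generalizedInverse_mul (M : Matrix ι ι ℝ) : M * generalizedInverse M * M = M :=
  Classical.choose_spec (exists_generalizedInverse M)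

/-- `Kᵀ c` is estimable under `ξ`: `range K ⊆ range M(ξ)`. -/
def IsEstimable (f : ι → X → ℝ) (K : Matrix ι κ ℝ) (ξ : Measure X) : Prop :=
  LinearMap.range K.mulVecLin ≤ LinearMap.range (infoMatrix f ξ).mulVecLin

/-- The matrix `C_K(ξ) = (Kᵀ M(ξ)⁻ K)⁻¹`. -/
def coefMatrix (f : ι → X → ℝ) (K : Matrix ι κ ℝ) (ξ : Measure X) : Matrix κ κ ℝ :=
  (Kᵀ * generalizedInverse (infoMatrix f ξ) * K)⁻¹

/-- For an estimable `Kᵀ c` the matrix `C_K(ξ)` does not depend on the choice of the generalized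
inverse. -/
theorem coefMatrix_eq (f : ι → X → ℝ) (K : Matrix ι κ ℝ) (ξ : Measure X)
    (hK : IsEstimable f K ξ) (G : Matrix ι ι ℝ)
    (hG : infoMatrix f ξ * G * infoMatrix f ξ = infoMatrix f ξ) :
    coefMatrix f K ξ = (Kᵀ * G * K)⁻¹ := by
  have hM : (infoMatrix f ξ)ᵀ = infoMatrix f ξ := by
    simpa [Matrix.IsHermitian, Matrix.conjTranspose_eq_transpose_of_trivial]
      using infoMatrix_isHermitian f ξ
  have hH := mul_generalizedInverse_mul (infoMatrix f ξ)
  unfold coefMatrix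
  unfold IsEstimable at hK
  generalize generalizedInverse (infoMatrix f ξ) = H at *
  generalize infoMatrix f ξ = M at *
  have hX : ∃ L : Matrix ι κ ℝ, K = M * L := by
    choose v hv using fun b : κ => hK ⟨Pi.single b 1, rfl⟩
    refine ⟨Matrix.of fun a b => v b a, ?_⟩
    ext a b
    have := congrFun (hv b) a
    simp only [Matrix.mulVecLin_apply, Matrix.mulVec_single_one] at this
    simpa [Matrix.mul_apply, Matrix.mulVec, dotProduct] using this.symm
  obtain ⟨L, rfl⟩ := hX
  congr 1
  rw [Matrix.transpose_mul, hM]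
  have e (G : Matrix ι ι ℝ) : Lᵀ * M * G * (M * L) = Lᵀ * (M * G * M) * L := by
    simp only [Matrix.mul_assoc]
  rw [e, e, hH, hG]

/-- Kiefer's criterion `Φ_p`, `p ∈ [-∞, ∞)`, as a function of `C = C_K(ξ)`:
`(tr C^p)^{1/p}` for real `p ≠ 0` (`C^p` by the functional calculus of symmetric matrices),
with the usual readings `(det C)^{1/s}` (`D`-optimality) for `p = 0`, where `s` is the size
of `C`, and `λ_min(C)` (`E`-optimality) for `p = -∞`. -/
def kieferCriterion (C : Matrix κ κ ℝ) : WithBot ℝ → ℝ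
  | ⊥ => sInf (spectrum ℝ C)
  | (p : ℝ) =>
      if p = 0 then C.det ^ (1 / (Fintype.card κ : ℝ))
      else (cfc (fun x : ℝ => x ^ p) C).trace ^ (1 / p)

/-- `ξ` is `Φ_p`-optimal for estimating `Kᵀ c`: it maximises `Φ_p` among all designs on `S` for
which `Kᵀ c` is estimable. -/
def IsPhiOptimal (S : Set X) (f : ι → X → ℝ) (K : Matrix ι κ ℝ) (p : WithBot ℝ)
    (ξ : Measure X) : Prop :=
  IsDesign S ξ ∧ IsEstimable f K ξ ∧
    ∀ η : Measure X, IsDesign S η → IsEstimable f K η →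
      kieferCriterion (coefMatrix f K η) p ≤ kieferCriterion (coefMatrix f K ξ) p

/-- The sum of the `s` smallest eigenvalues, counted with multiplicity, of a symmetric matrix.
(`eigenvalues₀` lists the eigenvalues in nonincreasing order.) -/
def sumSmallestEigenvalues {A : Matrix ι ι ℝ} (hA : A.IsHermitian) (s : ℕ) : ℝ :=
  ∑ i : Fin (Fintype.card ι), if (i : ℕ) < s then hA.eigenvalues₀ i.rev else 0

/-- `ξ` is `Φ_{E_s}`-optimal: it maximises the sum of the `s` smallest eigenvalues of the
information matrix among all designs on `S`. -/
def IsPhiEOptimal (S : Set X) (f : ι → X → ℝ) (s : ℕ) (ξ : Measure X) : Prop :=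
  IsDesign S ξ ∧ ∀ η : Measure X, IsDesign S η →
    sumSmallestEigenvalues (infoMatrix_isHermitian f η) s ≤
      sumSmallestEigenvalues (infoMatrix_isHermitian f ξ) s

end General

/-! ## Real hyperspherical harmonics -/

/-- The Gegenbauer polynomial `C_k^α`, by its three term recurrence
`(k+2) C_{k+2} = 2 (k+1+α) x C_{k+1} - (k+2α) C_k`. -/
def gegenbauer (α : ℝ) : ℕ → Polynomial ℝ
  | 0 => 1
  | 1 => Polynomial.C (2 * α) * Polynomial.X
  | k + 2 => Polynomial.C (1 / ((k : ℝ) + 2)) *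
      (Polynomial.C (2 * ((k : ℝ) + 1 + α)) * Polynomial.X * gegenbauer α (k + 1)
        - Polynomial.C ((k : ℝ) + 2 * α) * gegenbauer α k)

/-- The associated Legendre function at a cosine,
`P_l^k(cos θ) = (-1)^k (2k)! / (2^k k!) (sin θ)^k C_{l-k}^{k+1/2}(cos θ)`, for `0 ≤ k ≤ l`. -/
def legendreCos (l k : ℕ) (θ : ℝ) : ℝ :=
  (-1) ^ k * ((2 * k).factorial : ℝ) / (2 ^ k * (k.factorial : ℝ)) * Real.sin θ ^ k *
    (gegenbauer ((k : ℝ) + 1 / 2) (l - k)).eval (Real.cos θ)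

/-- Multi-indices `(μ_0, μ_1, …, μ_{m-3}, μ_{m-2})` of level `μ_0 = l`: the first component of the
pair is `(μ_0, …, μ_{m-3})` with `l = μ_0 ≥ μ_1 ≥ … ≥ μ_{m-3} ≥ 0`, the second component is
`μ_{m-2}`, an integer with `-μ_{m-3} ≤ μ_{m-2} ≤ μ_{m-3}`. -/
def levelSet (n l : ℕ) : Finset ((Fin (n + 1) → ℕ) × ℤ) :=
  ((Fintype.piFinset fun _ => Finset.range (l + 1)) ×ˢ Finset.Icc (-(l : ℤ)) l).filter
    fun a => a.1 0 = l ∧ (∀ i j, i ≤ j → a.1 j ≤ a.1 i) ∧ |a.2| ≤ (a.1 (Fin.last n) : ℤ)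

theorem mem_levelSet {n l : ℕ} {a : (Fin (n + 1) → ℕ) × ℤ} :
    a ∈ levelSet n l ↔ a.1 0 = l ∧ Antitone a.1 ∧ |a.2| ≤ (a.1 (Fin.last n) : ℤ) := by
  simp only [levelSet, Finset.mem_filter, Finset.mem_product, Fintype.mem_piFinset,
    Finset.mem_range, Finset.mem_Icc]
  constructor
  · rintro ⟨-, h0, h1, h2⟩
    exact ⟨h0, fun i j h => h1 i j h, h2⟩
  · rintro ⟨h0, h1, h2⟩
    have h3 : ∀ i, a.1 i ≤ l := fun i => h0 ▸ h1 (Fin.zero_le i)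
    have h4 := h3 (Fin.last n)
    have h5 := abs_le.mp h2
    exact ⟨⟨fun i => Nat.lt_succ_of_le (h3 i), by omega, by omega⟩, h0, fun i j h => h1 h, h2⟩

/-- The type of multi-indices of level `l`. -/
abbrev Level (n l : ℕ) : Type := {a // a ∈ levelSet n l}

/-- The type of multi-indices of level at most `d`, grouped by level; its cardinality is the
number `D` of regression functions. -/
abbrev Row (n d : ℕ) : Type := Σ l : Fin (d + 1), Level n l

/-- The factor of the constant `A` attached to the angle `θ_i`, `i = j + 1 ≤ m - 3`, with
`a = μ_{i-1}`, `b = μ_i` and `m = n + 3`: the square root of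
`2^(2μ_i + m-i-3) (μ_{i-1}-μ_i)! (2μ_{i-1}+m-i-1) Γ(μ_i+(m-i-1)/2)² / (π (μ_{i-1}+μ_i+m-i-2)!)`. -/
def polarConst (n j a b : ℕ) : ℝ :=
  √(2 ^ (2 * b + (n - 1 - j)) * ((a - b).factorial : ℝ) * (2 * a + (n + 1 - (j : ℕ) : ℕ)) *
      Real.Gamma (b + ((n + 1 - (j : ℕ) : ℕ) : ℝ) / 2) ^ 2 /
    (Real.pi * ((a + b + (n - j)).factorial : ℝ)))

/-- The constant `B_{l,k} = (2 (2l+1) (l-k)! / (4 π (l+k)!))^{1/2}`. -/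
def legendreConst (l k : ℕ) : ℝ :=
  √(2 * (2 * l + 1) * ((l - k).factorial : ℝ) / (4 * Real.pi * ((l + k).factorial : ℝ)))

/-- The azimuthal factor: `cos (k φ)` for index `k > 0`, `sin (k φ)` for index `-k < 0` and
`1 / √2` for index `0`. -/
def azimuthal (k : ℤ) (φ : ℝ) : ℝ :=
  if 0 < k then Real.cos (k * φ) else if k < 0 then Real.sin (-k * φ) else 1 / √2

/-- The real hyperspherical harmonic `Y_{μ_0, …, μ_{m-2}}(θ_1, …, θ_{m-2}, φ)`. -/
def hypersphericalHarmonic {n : ℕ} (μ : (Fin (n + 1) → ℕ) × ℤ) (x : (Fin (n + 1) → ℝ) × ℝ) : ℝ :=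
  (∏ j : Fin n, polarConst n j (μ.1 j.castSucc) (μ.1 j.succ) *
      ((gegenbauer (μ.1 j.succ + ((n + 1 - (j : ℕ) : ℕ) : ℝ) / 2) (μ.1 j.castSucc - μ.1 j.succ)).eval
          (Real.cos (x.1 j.castSucc)) *
        Real.sin (x.1 j.castSucc) ^ μ.1 j.succ)) *
    (legendreConst (μ.1 (Fin.last n)) μ.2.natAbs *
      legendreCos (μ.1 (Fin.last n)) μ.2.natAbs (x.1 (Fin.last n)) * azimuthal μ.2 x.2)

/-- The vector `f_d` of all hyperspherical harmonics of level at most `d`. -/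
def regressionFunctions (n d : ℕ) (a : Row n d) (x : (Fin (n + 1) → ℝ) × ℝ) : ℝ :=
  hypersphericalHarmonic a.2.1 x

/-- The design space `[0, π]^{m-2} × [-π, π]` of angles. -/
def angleSpace (n : ℕ) : Set ((Fin (n + 1) → ℝ) × ℝ) :=
  {x | (∀ j, x.1 j ∈ Set.Icc 0 Real.pi) ∧ x.2 ∈ Set.Icc (-Real.pi) Real.pi}

/-- The total solid angle
`Ω = ∫_{[0,π]^{m-2} × [-π,π]} (sin θ_1)^{m-2} (sin θ_2)^{m-3} ⋯ sin θ_{m-2} dθ_1 ⋯ dθ_{m-2} dφ`. -/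
def solidAngle (n : ℕ) : ℝ :=
  ∫ x in angleSpace n, ∏ j : Fin (n + 1), Real.sin (x.1 j) ^ (n + 1 - (j : ℕ) : ℕ)

/-- The number `s(k) = (m+2k-2) (k+m-3)! / (k! (m-2)!)` (an exact division for `m ≥ 3`) of
hyperspherical harmonics of level `k` on the sphere in `ℝ^m`. -/
def levelDim (m k : ℕ) : ℕ :=
  (m + 2 * k - 2) * (k + m - 3).factorial / (k.factorial * (m - 2).factorial)

/-- The columns of `K`: the multi-indices of the selected levels `k_0 < ⋯ < k_q`. -/
abbrev Column (n : ℕ) {q : ℕ} (k : Fin (q + 1) → ℕ) : Type := Σ j : Fin (q + 1), Level n (k j)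

/-- The matrix `K`: its transpose consists of blocks `K_{j,l}` (`0 ≤ j ≤ q`, `0 ≤ l ≤ d`), which are
the identity for `l = k_j` and zero otherwise. -/
def selectionMatrix (n d : ℕ) {q : ℕ} (k : Fin (q + 1) → ℕ) :
    Matrix (Row n d) (Column n k) ℝ :=
  Matrix.of fun a b => if (a.1 : ℕ) = k b.1 ∧ a.2.1 = b.2.1 then 1 else 0

/-! ## The discrete product designs -/

/-- The nodes `-1 ≤ x_1 < ⋯ < x_r ≤ 1` and the positive weights `w_1, …, w_r` with sum `1` form a
quadrature formula of degree `z` for the weight function `a` on `[-1, 1]`. -/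
structure IsQuadrature (a : ℝ → ℝ) (z : ℕ) {r : ℕ} (x w : Fin r → ℝ) : Prop where
  strictMono : StrictMono x
  mem_Icc : ∀ j, x j ∈ Set.Icc (-1 : ℝ) 1
  pos : ∀ j, 0 < w j
  sum_eq_one : ∑ j, w j = 1
  exact_pow : ∀ l ≤ z, ∫ y in (-1 : ℝ)..1, a y * y ^ l =
    (∫ y in (-1 : ℝ)..1, a y) * ∑ j, w j * x j ^ l

/-- The weight function `(1 - y²)^{(m-i-2)/2}` for the angle `θ_i`, `i = j + 1`, `m = n + 3`. -/
def polarWeight (n j : ℕ) (y : ℝ) : ℝ := (1 - y ^ 2) ^ (((n - j : ℕ) : ℝ) / 2)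

/-- The design `ζ` with masses `w_j` at the angles `arccos x_j`. -/
def polarDesign {r : ℕ} (x w : Fin r → ℝ) : Measure ℝ :=
  ∑ j, ENNReal.ofReal (w j) • Measure.dirac (Real.arccos (x j))

/-- The design `ν(β, t)` with masses `1/t` at the angles `β + 2πj/t`, `j = 1, …, t`. -/
def azimuthDesign (β : ℝ) (t : ℕ) : Measure ℝ :=
  ∑ j ∈ Finset.Icc 1 t,
    ENNReal.ofReal (1 / (t : ℝ)) • Measure.dirac (β + 2 * Real.pi * (j : ℝ) / (t : ℝ))

/-- The product design `ζ_1 ⊗ ⋯ ⊗ ζ_{m-2} ⊗ ν(β, t)`. -/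
def productDesign {n r : ℕ} (x w : Fin (n + 1) → Fin r → ℝ) (β : ℝ) (t : ℕ) :
    Measure ((Fin (n + 1) → ℝ) × ℝ) :=
  (Measure.pi fun i => polarDesign (x i) (w i)).prod (azimuthDesign β t)

end HypersphericalDesign

end

open HypersphericalDesign

namespace HypersphericalDesign
open MeasureTheory Matrix

/-! ## Gegenbauer polynomials -/

/-! Write `c = 1/Ω`, where `Ω` is the solid angle. Two facts about the harmonics carry the theorem.

Orthogonality: each harmonic is, up to a sign and `1/√π`, a product of polar factors in the single
angles and a trigonometric factor (`hypersphericalHarmonic_eq`). A product of two polar factors with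
the same lower index is a polynomial in `cos θ` of degree at most `2d`. The quadrature therefore
reproduces the Gegenbauer orthogonality relations, and `t` equidistant angles integrate all
frequencies below `t` exactly. Hence `M(ξ) = c I` (`infoMatrix_productDesign`). Since the Gegenbauer
polynomials are given only by their recurrence, their derivative rule, differential equation and
orthogonality are derived from it.

Constant sums of squares: the squares of the harmonics of one level add up to a constant
(`exists_sum_levelSet_sq`). This goes by induction on the dimension: the sum over the second index
has derivative zero because the terms telescope through the differential equation. Consequently
`tr(Kᵀ M(η) K)` is the same number for every design `η`, and evaluating it at `ξ` gives `s c`.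
Comparing with level `0` also yields the number of harmonics of each level.

Optimality is then linear algebra. As `Kᵀ K = 1`, one has `C_K(η) ≤ Kᵀ M(η) K` in the Loewner order,
so `tr C_K(η) ≤ s c`. Among positive definite matrices with trace at most `s c`, power mean
inequalities show that `c I` maximises every `Φ_p` with `p < 1`, and `C_K(ξ) = c I`. For `Φ_{E_s}`,
Ky Fan's inequality bounds the `s` smallest eigenvalues of `M(η)` by the `s` diagonal entries
selected by `K`, whose sum is again `s c`. -/

theorem gegenbauer_eval_zero (α x : ℝ) : (gegenbauer α 0).eval x = 1 := by simp [gegenbauer]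

theorem gegenbauer_eval_one (α x : ℝ) : (gegenbauer α 1).eval x = 2 * α * x := by
  simp [gegenbauer]

theorem gegenbauer_eval_add_two (α x : ℝ) (k : ℕ) :
    (k + 2) * (gegenbauer α (k + 2)).eval x =
      2 * (k + 1 + α) * x * (gegenbauer α (k + 1)).eval x
        - (k + 2 * α) * (gegenbauer α k).eval x := by
  have : (k : ℝ) + 2 ≠ 0 := by positivity
  simp only [gegenbauer, Polynomial.eval_mul, Polynomial.eval_sub, Polynomial.eval_C,
    Polynomial.eval_X]
  field_simp

theorem natDegree_gegenbauer_le (α : ℝ) : ∀ k, (gegenbauer α k).natDegree ≤ k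
  | 0 => by simp [gegenbauer]
  | 1 => by
    simp only [gegenbauer]
    exact (Polynomial.natDegree_C_mul_le _ _).trans Polynomial.natDegree_X_le
  | k + 2 => by
    have h0 := natDegree_gegenbauer_le α k
    have h1 := natDegree_gegenbauer_le α (k + 1)
    simp only [gegenbauer]
    refine (Polynomial.natDegree_C_mul_le _ _).trans ((Polynomial.natDegree_sub_le _ _).trans ?_)
    refine max_le (Polynomial.natDegree_mul_le.trans ?_)
      ((Polynomial.natDegree_C_mul_le _ _).trans (by omega))
    have := (Polynomial.natDegree_C_mul_le (2 * ((k : ℝ) + 1 + α)) Polynomial.X).trans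
      Polynomial.natDegree_X_le
    omega

/-- Two relations between the Gegenbauer polynomials of parameters `α` and `α + 1`. -/
theorem gegenbauer_eval_parameter_succ (α x : ℝ) (k : ℕ) :
    (k + 1 + 2 * α) * (gegenbauer α (k + 1)).eval x =
        2 * α * ((gegenbauer (α + 1) (k + 1)).eval x - x * (gegenbauer (α + 1) k).eval x) ∧
      (k + 2) * (gegenbauer α (k + 2)).eval x =
        2 * α * (x * (gegenbauer (α + 1) (k + 1)).eval x - (gegenbauer (α + 1) k).eval x) := by
  induction k with
  | zero =>
    have := gegenbauer_eval_add_two α x 0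
    simp only [gegenbauer_eval_zero, gegenbauer_eval_one, zero_add, Nat.cast_zero] at *
    exact ⟨by ring, by rw [this]; ring⟩
  | succ k ih =>
    obtain ⟨ihA, ihB⟩ := ih
    have r1 := gegenbauer_eval_add_two α x (k + 1)
    have r2 := gegenbauer_eval_add_two (α + 1) x k
    push_cast at *
    have hk : (k : ℝ) + 2 ≠ 0 := by positivity
    -- The induction interlocks: the first relation at `k + 1` uses the second at `k` and the
    -- recurrence for `α + 1`, and the second at `k + 1` then uses the first.
    have hA : (k + 1 + 1 + 2 * α) * (gegenbauer α (k + 1 + 1)).eval x =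
        2 * α * ((gegenbauer (α + 1) (k + 1 + 1)).eval x
          - x * (gegenbauer (α + 1) (k + 1)).eval x) := by
      apply mul_left_cancel₀ hk
      linear_combination (k + 2 + 2 * α) * ihB - 2 * α * r2
    refine ⟨hA, ?_⟩
    linear_combination r1 + x * hA + x * ihB - ihA

/-- Differentiating the recurrence leaves one undifferentiated term, `2(k+2+α) C_{k+2}^α`. This
coefficient is the sum of those in the two parameter relations, so adding these relations expresses
the term through parameter `α + 1`. -/
theorem gegenbauer_derivative_eval (α x : ℝ) : ∀ k : ℕ,
    (gegenbauer α (k + 1)).derivative.eval x = 2 * α * (gegenbauer (α + 1) k).eval x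
  | 0 => by simp [gegenbauer]
  | 1 => by
    simp [gegenbauer]
    ring
  | k + 2 => by
    have h0 := gegenbauer_derivative_eval α x k
    have h1 := gegenbauer_derivative_eval α x (k + 1)
    have hA := (gegenbauer_eval_parameter_succ α x (k + 1)).1
    have hB := (gegenbauer_eval_parameter_succ α x k).2
    have r := gegenbauer_eval_add_two (α + 1) x k
    have hk : (k : ℝ) + 3 ≠ 0 := by positivity
    rw [gegenbauer]
    simp only [Polynomial.derivative_mul, Polynomial.derivative_sub, Polynomial.derivative_C,
      Polynomial.derivative_X, Polynomial.eval_mul, Polynomial.eval_sub, Polynomial.eval_C,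
      Polynomial.eval_X, Polynomial.eval_add, Polynomial.eval_one, Polynomial.eval_zero, h0, h1]
    push_cast at *
    have e : (k : ℝ) + 1 + 2 = k + 3 := by ring
    rw [e]
    apply mul_left_cancel₀ hk
    field_simp
    linear_combination hA + hB - 2 * α * r

/-- The `b`-th element `C_{l-b}^{α+b}` of the chain of Gegenbauer polynomials obtained from
`C_l^α` by differentiation (zero for `b > l`). -/
noncomputable def gegenbauerChain (α : ℝ) (l b : ℕ) (x : ℝ) : ℝ :=
  if b ≤ l then (gegenbauer (α + b) (l - b)).eval x else 0

/-- The convention of value zero for `b > l` agrees with the derivative of the constant `C_0`, so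
the rule needs no side condition and sums over `b` may run one index too far. -/
theorem hasDerivAt_gegenbauerChain (α : ℝ) (l b : ℕ) (x : ℝ) :
    HasDerivAt (gegenbauerChain α l b) (2 * (α + b) * gegenbauerChain α l (b + 1) x) x := by
  unfold gegenbauerChain
  rcases lt_trichotomy b l with h | rfl | h
  · obtain ⟨c, rfl⟩ := Nat.exists_eq_add_of_lt h
    have e1 : b + c + 1 - b = c + 1 := by omega
    have e2 : b + c + 1 - (b + 1) = c := by omega
    have h2 : b + 1 ≤ b + c + 1 := by omega
    simp only [h.le, h2, if_true, e1, e2]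
    have := (gegenbauer (α + b) (c + 1)).hasDerivAt x
    rw [gegenbauer_derivative_eval] at this
    push_cast
    rwa [add_assoc] at this
  · have h2 : ¬ b + 1 ≤ b := by omega
    simpa [gegenbauer_eval_zero] using hasDerivAt_const x (1 : ℝ)
  · have h1 : ¬ b ≤ l := by omega
    have h2 : ¬ b + 1 ≤ l := by omega
    simpa [h1, h2] using hasDerivAt_const x (0 : ℝ)

/-- The Gegenbauer differential equation. -/
theorem gegenbauerChain_ode (α x : ℝ) (l b : ℕ) (h : b ≤ l) :
    4 * (α + b) * (α + b + 1) * (1 - x ^ 2) * gegenbauerChain α l (b + 2) x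
      - 2 * (α + b) * (2 * α + 2 * b + 1) * x * gegenbauerChain α l (b + 1) x
      + (l - b) * (l + b + 2 * α) * gegenbauerChain α l b x = 0 := by
  obtain ⟨c, rfl⟩ := Nat.exists_eq_add_of_le h
  unfold gegenbauerChain
  match c with
  | 0 => simp
  | 1 =>
    simp [gegenbauer_eval_zero, gegenbauer_eval_one]
    ring
  | 2 =>
    have := gegenbauer_eval_add_two (α + b) x 0
    have e1 : b + 2 - (b + 1) = 1 := by omega
    simp [gegenbauer_eval_zero, gegenbauer_eval_one, e1] at *
    linear_combination (2 * α + 2 * b + 2) * this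
  | c + 3 =>
    have e0 : b + (c + 3) - b = c + 3 := by omega
    have e1 : b + (c + 3) - (b + 1) = c + 2 := by omega
    have e2 : b + (c + 3) - (b + 2) = c + 1 := by omega
    have h0 : b ≤ b + (c + 3) := by omega
    have h1 : b + 1 ≤ b + (c + 3) := by omega
    have h2 : b + 2 ≤ b + (c + 3) := by omega
    simp only [h0, h1, h2, if_true, e0, e1, e2]
    have hB := (gegenbauer_eval_parameter_succ (α + b) x (c + 1)).2
    obtain ⟨hA', -⟩ := gegenbauer_eval_parameter_succ (α + b + 1) x c
    obtain ⟨-, hB'⟩ := gegenbauer_eval_parameter_succ (α + b + 1) x c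
    push_cast at *
    have e3 : α + (b + 2) = α + b + 1 + 1 := by ring
    have e4 : α + (b + 1) = α + b + 1 := by ring
    rw [e3, e4]
    linear_combination (c + 3 + 2 * b + 2 * α) * hB + 2 * (α + b) * x * hB' - 2 * (α + b) * hA'

/-- The value is the binomial coefficient `(N+k choose k)`, written without division so that the
recurrence applies directly. -/
theorem gegenbauer_eval_at_one (N : ℕ) : ∀ k : ℕ,
    (gegenbauer (((N + 1 : ℕ) : ℝ) / 2) k).eval 1 * (N.factorial * k.factorial) =
      ((N + k).factorial : ℝ)
  | 0 => by simp [gegenbauer_eval_zero]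
  | 1 => by
    rw [gegenbauer_eval_one, Nat.factorial_succ N, Nat.factorial_one]
    push_cast
    ring
  | k + 2 => by
    have h0 := gegenbauer_eval_at_one N k
    have h1 := gegenbauer_eval_at_one N (k + 1)
    have r := gegenbauer_eval_add_two (((N + 1 : ℕ) : ℝ) / 2) 1 k
    rw [show N + (k + 2) = N + k + 1 + 1 by ring, Nat.factorial_succ (N + k + 1),
      Nat.factorial_succ (N + k), Nat.factorial_succ (k + 1), Nat.factorial_succ k]
    rw [show N + (k + 1) = N + k + 1 by ring, Nat.factorial_succ (N + k), Nat.factorial_succ k] at h1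
    push_cast at *
    linear_combination (N.factorial : ℝ) * ((k + 1) * k.factorial) * r
      + (2 * k + 2 + N + 1) * h1 - (k + N + 1) * (k + 1) * h0

/-! ## Orthogonality of Gegenbauer polynomials -/

/-- Integration by parts with the differential equation in Sturm–Liouville form. The boundary terms
vanish because of the factor `sin^(K+1)`. -/
theorem gegenbauer_inner_recursion (K n m : ℕ) :
    ((n : ℝ) + 1) * (n + 1 + K) * ∫ θ in (0 : ℝ)..Real.pi, Real.sin θ ^ K *
      ((gegenbauer ((K : ℝ) / 2) (n + 1)).eval (Real.cos θ) *
        (gegenbauer ((K : ℝ) / 2) m).eval (Real.cos θ)) =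
    ∫ θ in (0 : ℝ)..Real.pi, Real.sin θ ^ (K + 2) *
      (K * (gegenbauer (((K + 2 : ℕ) : ℝ) / 2) n).eval (Real.cos θ) *
        (gegenbauer ((K : ℝ) / 2) m).derivative.eval (Real.cos θ)) := by
  rw [← intervalIntegral.integral_const_mul, ← sub_eq_zero,
    ← intervalIntegral.integral_sub]
  rotate_left
  · apply Continuous.intervalIntegrable; fun_prop
  · apply Continuous.intervalIntegrable; fun_prop
  set α := (K : ℝ) / 2 with hα
  have e1 : ((K + 2 : ℕ) : ℝ) / 2 = α + 1 := by rw [hα]; push_cast; ring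
  have hK : (K : ℝ) = 2 * α := by rw [hα]; ring
  rw [e1]
  have key : ∀ θ ∈ Set.uIcc 0 Real.pi, HasDerivAt
      (fun θ => Real.sin θ ^ (K + 1) * (2 * α * gegenbauerChain α (n + 1) 1 (Real.cos θ)) *
        (gegenbauer α m).eval (Real.cos θ))
      (((n : ℝ) + 1) * (n + 1 + K) * (Real.sin θ ^ K * ((gegenbauer α (n + 1)).eval (Real.cos θ) *
        (gegenbauer α m).eval (Real.cos θ))) - Real.sin θ ^ (K + 2) *
      (K * (gegenbauer (α + 1) n).eval (Real.cos θ) *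
        (gegenbauer α m).derivative.eval (Real.cos θ))) θ := by
    intro θ _
    have hs : HasDerivAt (fun θ => Real.sin θ ^ (K + 1)) _ θ := (Real.hasDerivAt_sin θ).pow (K + 1)
    have hc : HasDerivAt (fun θ => gegenbauerChain α (n + 1) 1 (Real.cos θ)) _ θ :=
      (hasDerivAt_gegenbauerChain α (n + 1) 1 (Real.cos θ)).comp θ (Real.hasDerivAt_cos θ)
    have hm : HasDerivAt (fun θ => (gegenbauer α m).eval (Real.cos θ)) _ θ :=
      ((gegenbauer α m).hasDerivAt (Real.cos θ)).comp θ (Real.hasDerivAt_cos θ)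
    have ode := gegenbauerChain_ode α (Real.cos θ) (n + 1) 0 (by omega)
    have v0 : gegenbauerChain α (n + 1) 0 (Real.cos θ) =
        (gegenbauer α (n + 1)).eval (Real.cos θ) := by simp [gegenbauerChain]
    have v1 : gegenbauerChain α (n + 1) 1 (Real.cos θ) =
        (gegenbauer (α + 1) n).eval (Real.cos θ) := by simp [gegenbauerChain]
    refine ((hs.mul (hc.const_mul (2 * α))).mul hm).congr_deriv ?_
    rw [← v0, ← v1]
    have hsq := Real.sin_sq_add_cos_sq θ
    have hsq' : 1 - Real.cos θ ^ 2 = Real.sin θ ^ 2 := by linarith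
    rw [hsq'] at ode
    simp only [Nat.add_sub_cancel, Nat.cast_add, Nat.cast_one, Nat.cast_zero, zero_add,
      add_zero] at *
    rw [hK]
    simp only [pow_succ, Pi.mul_apply] at *
    linear_combination (-1) * Real.sin θ ^ K * (gegenbauer α m).eval (Real.cos θ) * ode
  rw [intervalIntegral.integral_eq_sub_of_hasDerivAt key]
  · simp
  · apply Continuous.intervalIntegrable; fun_prop

/-- The integral `∫ sin^K` in terms of the Gamma function. -/
theorem integral_sin_pow_eq_gamma : ∀ K : ℕ, (∫ θ in (0 : ℝ)..Real.pi, Real.sin θ ^ (K + 1)) *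
    (2 ^ K * (((K : ℝ) + 1) * Real.Gamma (((K + 1 : ℕ) : ℝ) / 2) ^ 2)) =
      2 * Real.pi * K.factorial
  | 0 => by
    have : Real.Gamma (((0 + 1 : ℕ) : ℝ) / 2) ^ 2 = Real.pi := by
      norm_num
      rw [Real.Gamma_one_half_eq, Real.sq_sqrt Real.pi_pos.le]
    rw [this]
    simp
    ring
  | 1 => by
    have := integral_sin_pow (a := 0) (b := Real.pi) 0
    norm_num at this ⊢
    rw [this]
    ring
  | K + 2 => by
    have h := integral_sin_pow_eq_gamma K
    have hr := integral_sin_pow (a := 0) (b := Real.pi) (K + 1)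
    have hg : Real.Gamma (((K + 2 + 1 : ℕ) : ℝ) / 2) =
        ((K + 1 : ℕ) : ℝ) / 2 * Real.Gamma (((K + 1 : ℕ) : ℝ) / 2) := by
      rw [← Real.Gamma_add_one (by positivity)]
      congr 1
      push_cast; ring
    rw [show K + 2 + 1 = K + 1 + 2 by ring] at *
    rw [hr, hg, Nat.factorial_succ, Nat.factorial_succ]
    simp only [Real.sin_zero, Real.sin_pi]
    push_cast at *
    have : (K : ℝ) + 1 + 2 ≠ 0 := by positivity
    field_simp
    linear_combination 4 * (K + 2) * (K + 3) * h

/-- Each integration by parts lowers both degrees by one and raises `K` by two, since the derivative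
of `C_{m+1}^α` is a multiple of `C_m^{α+1}`. The descent ends when one degree is zero: the integral
is then `∫ sin^(K+1)`, or it vanishes because the derivative of a constant appears. -/
theorem gegenbauer_orthogonal (n m : ℕ) : ∀ K : ℕ,
    (∫ θ in (0 : ℝ)..Real.pi, Real.sin θ ^ (K + 1) *
      ((gegenbauer (((K + 1 : ℕ) : ℝ) / 2) n).eval (Real.cos θ) *
        (gegenbauer (((K + 1 : ℕ) : ℝ) / 2) m).eval (Real.cos θ))) *
      (2 ^ K * n.factorial * (2 * n + K + 1) * Real.Gamma (((K + 1 : ℕ) : ℝ) / 2) ^ 2) =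
      if n = m then 2 * Real.pi * ((n + K).factorial : ℝ) else 0 := by
  induction n generalizing m with
  | zero =>
    intro K
    cases m with
    | zero =>
      have := integral_sin_pow_eq_gamma K
      simp [gegenbauer_eval_zero] at *
      linear_combination this
    | succ m =>
      -- The roles are exchanged here so that the constant polynomial is the one differentiated.
      have := gegenbauer_inner_recursion (K + 1) m 0
      simp [gegenbauer] at this
      have h : ¬ ((m : ℝ) + 1 = 0 ∨ (m : ℝ) + 1 + (K + 1) = 0) := by
        rintro (h | h) <;> linarith [show (0 : ℝ) ≤ m by positivity,
          show (0 : ℝ) ≤ K by positivity]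
      have := this.resolve_left h
      simp [gegenbauer_eval_zero, this]
  | succ n ih =>
    intro K
    have hrec := gegenbauer_inner_recursion (K + 1) n m
    have hpos : ((n : ℝ) + 1) * (n + 1 + (K + 1 : ℕ)) ≠ 0 := by positivity
    cases m with
    | zero =>
      simp [gegenbauer] at hrec
      have h : ¬ ((n : ℝ) + 1 = 0 ∨ (n : ℝ) + 1 + (K + 1) = 0) := by
        rintro (h | h) <;> linarith [show (0 : ℝ) ≤ n by positivity,
          show (0 : ℝ) ≤ K by positivity]
      have := hrec.resolve_left h
      simp [gegenbauer_eval_zero, this]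
    | succ m =>
      have h := ih m (K + 2)
      have hg : Real.Gamma (((K + 2 + 1 : ℕ) : ℝ) / 2) =
          ((K + 1 : ℕ) : ℝ) / 2 * Real.Gamma (((K + 1 : ℕ) : ℝ) / 2) := by
        rw [← Real.Gamma_add_one (by positivity)]
        congr 1
        push_cast; ring
      rw [hg] at h
      have e : ((K + 1 : ℕ) : ℝ) / 2 + 1 = ((K + 2 + 1 : ℕ) : ℝ) / 2 := by push_cast; ring
      simp only [gegenbauer_derivative_eval, e] at hrec
      have e2 : ∀ θ : ℝ, Real.sin θ ^ (K + 1 + 2) *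
          (((K + 1 : ℕ) : ℝ) * (gegenbauer (((K + 1 + 2 : ℕ) : ℝ) / 2) n).eval (Real.cos θ) *
          (2 * (((K + 1 : ℕ) : ℝ) / 2) *
            (gegenbauer (((K + 2 + 1 : ℕ) : ℝ) / 2) m).eval (Real.cos θ))) =
          ((K + 1 : ℕ) : ℝ) ^ 2 * (Real.sin θ ^ (K + 2 + 1) *
          ((gegenbauer (((K + 2 + 1 : ℕ) : ℝ) / 2) n).eval (Real.cos θ) *
            (gegenbauer (((K + 2 + 1 : ℕ) : ℝ) / 2) m).eval (Real.cos θ))) := by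
        intro θ
        rw [show K + 1 + 2 = K + 2 + 1 by ring]
        ring
      simp only [e2, intervalIntegral.integral_const_mul] at hrec
      have hfac : ((n + (K + 2)).factorial : ℝ) =
          (n + 1 + (K + 1 : ℕ)) * ((n + 1 + K).factorial : ℝ) := by
        rw [show n + (K + 2) = n + 1 + K + 1 by ring, Nat.factorial_succ]
        push_cast; ring
      rw [hfac] at h
      apply mul_left_cancel₀ hpos
      rw [← mul_assoc, hrec, Nat.factorial_succ]
      split_ifs at h ⊢ with h1 h2 h2
      · push_cast at *
        linear_combination (n + 1) * h
      · omega
      · omega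
      · push_cast at *
        linear_combination (n + 1) * h

/-! ## The factors of the harmonics -/

/-- The squared normalising constant of `polarFactor`. -/
noncomputable def polarFactorConst (N a b : ℕ) : ℝ :=
  2 ^ (2 * b + N) * ((a - b).factorial : ℝ) * (2 * a + N + 1) *
      Real.Gamma (((2 * b + N + 1 : ℕ) : ℝ) / 2) ^ 2 /
    (2 * Real.pi * ((a + b + N).factorial : ℝ))

theorem polarFactorConst_nonneg (N a b : ℕ) : 0 ≤ polarFactorConst N a b := by
  unfold polarFactorConst
  positivity

/-- The functions `c C_{a-b}^{b+(N+1)/2}(cos θ) (sin θ)^b`, normalised to be orthonormal for the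
weight `(sin θ)^{N+1}` on `[0, π]`. -/
noncomputable def polarFactor (N a b : ℕ) (θ : ℝ) : ℝ :=
  √(polarFactorConst N a b) *
    ((gegenbauer (((2 * b + N + 1 : ℕ) : ℝ) / 2) (a - b)).eval (Real.cos θ) * Real.sin θ ^ b)

@[fun_prop]
theorem continuous_polarFactor (N a b : ℕ) : Continuous (polarFactor N a b) := by
  unfold polarFactor
  fun_prop

/-- The two factors `sin^b` join the weight and turn its exponent into `2b + N + 1`, which is twice
the Gegenbauer parameter. This works only for a common lower index `b`. -/
theorem polarFactor_orthonormal {N a a' b : ℕ} (h : b ≤ a) (h' : b ≤ a') :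
    (∫ θ in (0 : ℝ)..Real.pi, Real.sin θ ^ (N + 1) * (polarFactor N a b θ * polarFactor N a' b θ)) =
      if a = a' then 1 else 0 := by
  have key := gegenbauer_orthogonal (a - b) (a' - b) (2 * b + N)
  have e : ∀ θ : ℝ, Real.sin θ ^ (N + 1) * (polarFactor N a b θ * polarFactor N a' b θ) =
      √(polarFactorConst N a b) * √(polarFactorConst N a' b) * (Real.sin θ ^ (2 * b + N + 1) *
      ((gegenbauer (((2 * b + N + 1 : ℕ) : ℝ) / 2) (a - b)).eval (Real.cos θ) *
        (gegenbauer (((2 * b + N + 1 : ℕ) : ℝ) / 2) (a' - b)).eval (Real.cos θ))) := by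
    intro θ
    unfold polarFactor
    ring
  simp only [e, intervalIntegral.integral_const_mul]
  have hG : 0 < Real.Gamma (((2 * b + N + 1 : ℕ) : ℝ) / 2) := Real.Gamma_pos_of_pos (by positivity)
  have hne : ((2 : ℝ) ^ (2 * b + N) * (a - b).factorial * (2 * (a - b : ℕ) + (2 * b + N : ℕ) + 1) *
      Real.Gamma (((2 * b + N + 1 : ℕ) : ℝ) / 2) ^ 2) ≠ 0 := by positivity
  by_cases haa : a = a'
  · subst haa
    rw [Real.mul_self_sqrt (polarFactorConst_nonneg N a b)]
    rw [if_pos rfl] at key ⊢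
    rw [eq_div_of_mul_eq hne key, polarFactorConst]
    have e1 : a - b + (2 * b + N) = a + b + N := by omega
    have e2 : (2 * (a - b : ℕ) + (2 * b + N : ℕ) + 1 : ℝ) = 2 * a + N + 1 := by
      push_cast [Nat.cast_sub h]; ring
    rw [e2] at hne ⊢
    rw [e1]
    have := Real.pi_pos
    field_simp
  · have : ¬ a - b = a' - b := by omega
    rw [if_neg this] at key
    rw [if_neg haa, (mul_eq_zero.mp key).resolve_right hne, mul_zero]

theorem polarConst_mul_eq_polarFactor {n j a b : ℕ} (hj : j < n) (θ : ℝ) :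
    polarConst n j a b *
      ((gegenbauer (b + ((n + 1 - j : ℕ) : ℝ) / 2) (a - b)).eval (Real.cos θ) * Real.sin θ ^ b) =
    polarFactor (n - j) a b θ := by
  -- With `n = j + N + 1` all truncated subtractions in the constant are genuine.
  obtain ⟨N, rfl⟩ := Nat.exists_eq_add_of_lt hj
  have e1 : j + N + 1 - 1 - j = N := by omega
  have e2 : j + N + 1 + 1 - j = N + 2 := by omega
  have e3 : j + N + 1 - j = N + 1 := by omega
  have e4 : (b : ℝ) + ((N + 2 : ℕ) : ℝ) / 2 = ((2 * b + (N + 1) + 1 : ℕ) : ℝ) / 2 := by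
    push_cast; ring
  unfold polarConst polarFactor polarFactorConst
  rw [e1, e2, e3, e4]
  congr 2
  push_cast
  have := Real.pi_pos
  field_simp
  ring

/-- The value of `Γ(k + 1/2)`; the summand `0` is the `N = 0` of `polarFactorConst`. -/
theorem gamma_nat_add_half (k : ℕ) :
    Real.Gamma (((2 * k + 0 + 1 : ℕ) : ℝ) / 2) * (4 ^ k * k.factorial) =
      (2 * k).factorial * √Real.pi := by
  induction k with
  | zero => simp [← Real.Gamma_one_half_eq]
  | succ k ih =>
    have hg : Real.Gamma (((2 * (k + 1) + 0 + 1 : ℕ) : ℝ) / 2) =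
        ((2 * k + 0 + 1 : ℕ) : ℝ) / 2 * Real.Gamma (((2 * k + 0 + 1 : ℕ) : ℝ) / 2) := by
      rw [← Real.Gamma_add_one (by positivity)]
      congr 1
      push_cast; ring
    rw [hg, show 2 * (k + 1) = 2 * k + 1 + 1 by ring, Nat.factorial_succ (2 * k + 1),
      Nat.factorial_succ (2 * k),
      Nat.factorial_succ k]
    push_cast at *
    linear_combination (2 * k + 1) * (2 * k + 2) * ih

/-- The Legendre factor is the case `N = 0` of the polar factors. The factor `1/√π` left over later
normalises the trigonometric functions. -/
theorem legendre_eq_polarFactor (l k : ℕ) (θ : ℝ) :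
    legendreConst l k * legendreCos l k θ = (-1) ^ k * polarFactor 0 l k θ / √Real.pi := by
  have hpi := Real.pi_pos
  have hc : legendreConst l k * (((2 * k).factorial : ℝ) / (2 ^ k * k.factorial)) =
      √(polarFactorConst 0 l k) / √Real.pi := by
    have h2 : (((2 * k).factorial : ℝ) / (2 ^ k * k.factorial)) =
      √((((2 * k).factorial : ℝ) / (2 ^ k * k.factorial)) ^ 2) :=
        (Real.sqrt_sq (by positivity)).symm
    rw [h2, legendreConst, ← Real.sqrt_mul (by positivity), ← Real.sqrt_div' _ hpi.le]
    congr 1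
    unfold polarFactorConst
    have hg := gamma_nat_add_half k
    have hg' : Real.Gamma (((2 * k + 0 + 1 : ℕ) : ℝ) / 2) =
      (2 * k).factorial * √Real.pi / (4 ^ k * k.factorial) := by
      rw [eq_div_iff (by positivity), hg]
    rw [hg', div_pow, div_pow, mul_pow _ (√Real.pi), Real.sq_sqrt hpi.le]
    have h4 : (4 : ℝ) ^ k = 2 ^ k * 2 ^ k := by rw [← mul_pow]; norm_num
    rw [h4, pow_add, pow_mul', Nat.add_zero]
    push_cast
    field_simp
    ring
  have e : ((k : ℝ) + 1 / 2) = ((2 * k + 0 + 1 : ℕ) : ℝ) / 2 := by push_cast; ring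
  unfold legendreCos polarFactor
  rw [e]
  linear_combination (-1) ^ k * Real.sin θ ^ k *
    (gegenbauer (((2 * k + 0 + 1 : ℕ) : ℝ) / 2) (l - k)).eval (Real.cos θ) * hc

@[fun_prop]
theorem continuous_azimuthal (k : ℤ) : Continuous (azimuthal k) := by
  unfold azimuthal
  split_ifs <;> fun_prop

/-! ## Quadrature -/

theorem IsQuadrature.exact_polynomial {a : ℝ → ℝ} {z r : ℕ} {x w : Fin r → ℝ}
    (h : IsQuadrature a z x w) (ha : Continuous a) (p : Polynomial ℝ) (hp : p.natDegree ≤ z) :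
    ∫ y in (-1 : ℝ)..1, a y * p.eval y =
      (∫ y in (-1 : ℝ)..1, a y) * ∑ j, w j * p.eval (x j) := by
  simp only [p.eval_eq_sum_range, Finset.mul_sum]
  rw [intervalIntegral.integral_finsetSum, Finset.sum_comm]
  · refine Finset.sum_congr rfl fun i hi => ?_
    have hi' : i ≤ z := by
      have := Finset.mem_range.mp hi
      omega
    have e : ∀ y, a y * (p.coeff i * y ^ i) = p.coeff i * (a y * y ^ i) := fun y => by ring
    simp only [e, intervalIntegral.integral_const_mul, h.exact_pow i hi', Finset.mul_sum]
    exact Finset.sum_congr rfl fun j _ => by ring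
  · intro i _
    apply Continuous.intervalIntegrable
    fun_prop

theorem continuous_polarWeight (n j : ℕ) : Continuous (polarWeight n j) := by
  unfold polarWeight
  exact (by fun_prop : Continuous fun y : ℝ => 1 - y ^ 2).rpow_const fun _ => Or.inr (by positivity)

/-- Substitution `y = cos θ`; the Jacobian contributes the extra power of `sin θ`. -/
theorem integral_polarWeight_mul (n j : ℕ) {f : ℝ → ℝ} (hf : Continuous f) :
    ∫ y in (-1 : ℝ)..1, polarWeight n j y * f y =
      ∫ θ in (0 : ℝ)..Real.pi, Real.sin θ ^ (n - j + 1) * f (Real.cos θ) := by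
  have h := intervalIntegral.integral_comp_mul_deriv (a := 0) (b := Real.pi) (f := Real.cos)
    (f' := fun θ => -Real.sin θ) (g := fun y => polarWeight n j y * f y)
    (fun θ _ => Real.hasDerivAt_cos θ) (by fun_prop) ((continuous_polarWeight n j).mul hf)
  rw [Real.cos_zero, Real.cos_pi, intervalIntegral.integral_symm (-1) 1] at h
  rw [← neg_inj, ← h, ← intervalIntegral.integral_neg]
  refine intervalIntegral.integral_congr fun θ hθ => ?_
  rw [Set.uIcc_of_le Real.pi_pos.le] at hθ
  have hs := Real.sin_nonneg_of_mem_Icc hθ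
  have h1 : (1 : ℝ) - Real.cos θ ^ 2 = Real.sin θ ^ (2 : ℝ) := by
    rw [Real.rpow_two]; linarith [Real.sin_sq_add_cos_sq θ]
  simp only [Function.comp, polarWeight]
  rw [h1, ← Real.rpow_mul hs, mul_div_cancel₀ _ (two_ne_zero), Real.rpow_natCast]
  ring

/-- Since `sin^(2b) = (1 - cos²)^b`, the product is a polynomial in `cos θ` of degree at most `(a-b)
+ (a'-b) + 2b = a + a' ≤ 2d`, so the formula is exact for it. -/
theorem IsQuadrature.polarFactor_orthonormal {n j d r : ℕ} {x w : Fin r → ℝ}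
    (h : IsQuadrature (polarWeight n j) (2 * d) x w) {a a' b : ℕ} (hb : b ≤ a) (hb' : b ≤ a')
    (ha : a ≤ d) (ha' : a' ≤ d) :
    (∫ θ in (0 : ℝ)..Real.pi, Real.sin θ ^ (n - j + 1)) *
      ∑ i, w i * (polarFactor (n - j) a b (Real.arccos (x i)) *
        polarFactor (n - j) a' b (Real.arccos (x i))) = if a = a' then 1 else 0 := by
  rw [← HypersphericalDesign.polarFactor_orthonormal (N := n - j) hb hb']
  set α : ℝ := ((2 * b + (n - j) + 1 : ℕ) : ℝ) / 2 with hα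
  set p : Polynomial ℝ := Polynomial.C (√(polarFactorConst (n - j) a b) *
    √(polarFactorConst (n - j) a' b)) * ((gegenbauer α (a - b) * gegenbauer α (a' - b)) *
      (1 - Polynomial.X ^ 2) ^ b) with hp
  have hdeg : p.natDegree ≤ 2 * d := by
    refine (Polynomial.natDegree_C_mul_le _ _).trans (Polynomial.natDegree_mul_le.trans ?_)
    have h1 : (gegenbauer α (a - b) * gegenbauer α (a' - b)).natDegree ≤ a - b + (a' - b) :=
      Polynomial.natDegree_mul_le.trans (add_le_add (natDegree_gegenbauer_le _ _)
        (natDegree_gegenbauer_le _ _))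
    have h2 : ((1 - Polynomial.X ^ 2 : Polynomial ℝ) ^ b).natDegree ≤ b * 2 := by
      refine Polynomial.natDegree_pow_le.trans (Nat.mul_le_mul_left _ ?_)
      refine (Polynomial.natDegree_sub_le _ _).trans ?_
      simp
    omega
  have hev : ∀ θ : ℝ, polarFactor (n - j) a b θ * polarFactor (n - j) a' b θ =
      p.eval (Real.cos θ) := by
    intro θ
    have hs : 1 - Real.cos θ ^ 2 = Real.sin θ ^ 2 := by linarith [Real.sin_sq_add_cos_sq θ]
    simp only [hp, polarFactor, Polynomial.eval_mul, Polynomial.eval_C, Polynomial.eval_pow,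
      Polynomial.eval_sub, Polynomial.eval_one, Polynomial.eval_X, hs, ← hα]
    ring
  have h1 := h.exact_polynomial (continuous_polarWeight n j) p hdeg
  rw [integral_polarWeight_mul n j p.continuous] at h1
  have h2 := integral_polarWeight_mul n j (f := fun _ => 1) continuous_const
  simp only [mul_one] at h2
  rw [h2] at h1
  simp only [hev]
  rw [h1]
  congr 1
  refine Finset.sum_congr rfl fun i _ => ?_
  rw [Real.cos_arccos (h.mem_Icc i).1 (h.mem_Icc i).2]

/-! ### Integrals against the one-dimensional designs; equidistant angles -/

theorem integral_polarDesign {r : ℕ} (x w : Fin r → ℝ) (hw : ∀ i, 0 ≤ w i) (f : ℝ → ℝ) :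
    ∫ θ, f θ ∂(polarDesign x w) = ∑ i, w i * f (Real.arccos (x i)) := by
  unfold polarDesign
  rw [integral_finsetSum_measure]
  · refine Finset.sum_congr rfl fun i _ => ?_
    rw [integral_smul_measure, integral_dirac, ENNReal.toReal_ofReal (hw i), smul_eq_mul]
  · intro i _
    exact (integrable_dirac (by simp)).smul_measure ENNReal.ofReal_ne_top

theorem integral_azimuthDesign (β : ℝ) (t : ℕ) (f : ℝ → ℝ) :
    ∫ φ, f φ ∂(azimuthDesign β t) =
      1 / t * ∑ j ∈ Finset.Icc 1 t, f (β + 2 * Real.pi * (j : ℝ) / (t : ℝ)) := by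
  unfold azimuthDesign
  rw [integral_finsetSum_measure, Finset.mul_sum]
  · refine Finset.sum_congr rfl fun i _ => ?_
    rw [integral_smul_measure, integral_dirac, ENNReal.toReal_ofReal (by positivity), smul_eq_mul]
  · intro i _
    exact (integrable_dirac (by simp)).smul_measure ENNReal.ofReal_ne_top

/-- A full geometric sum of powers of a `t`-th root of unity, which differs from `1` because `t`
does not divide `m`. -/
theorem sum_exp_equidistant (β : ℝ) {t : ℕ} {m : ℤ} (hm : m ≠ 0) (hmt : |m| < t) :
    ∑ j ∈ Finset.Icc 1 t,
      Complex.exp (((m * (β + 2 * Real.pi * (j : ℝ) / (t : ℝ)) : ℝ) : ℂ) * Complex.I) = 0 := by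
  have ht : (t : ℂ) ≠ 0 := by
    have : 0 < |m| := abs_pos.mpr hm
    have : 0 < t := by omega
    exact_mod_cast this.ne'
  set ζ : ℂ := Complex.exp (m * (2 * Real.pi * Complex.I) / t) with hζ
  have hζt : ζ ^ t = 1 := by
    rw [hζ, ← Complex.exp_nat_mul, mul_div_cancel₀ _ ht, Complex.exp_int_mul_two_pi_mul_I]
  have hζ1 : ζ ≠ 1 := by
    intro h
    rw [hζ, Complex.exp_eq_one_iff] at h
    obtain ⟨c, hc⟩ := h
    have h2 : (2 * Real.pi * Complex.I : ℂ) ≠ 0 := Complex.two_pi_I_ne_zero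
    have h3 : (m : ℂ) = c * t := by
      field_simp at hc
      apply mul_right_cancel₀ h2
      linear_combination (2 * Real.pi * Complex.I : ℂ) * hc
    have h4 : m = c * t := by exact_mod_cast h3
    rw [h4, abs_mul, Nat.abs_cast] at hmt
    have : |c| < 1 := by
      by_contra hcon
      push Not at hcon
      nlinarith
    rw [Int.abs_lt_one_iff] at this
    rw [this] at h4
    exact hm (by simpa using h4)
  have e : ∀ j : ℕ,
      Complex.exp (((m * (β + 2 * Real.pi * (j : ℝ) / (t : ℝ)) : ℝ) : ℂ) * Complex.I) =
      Complex.exp (m * β * Complex.I) * ζ ^ j := by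
    intro j
    rw [hζ, ← Complex.exp_nat_mul, ← Complex.exp_add]
    congr 1
    push_cast
    field_simp
  simp only [e, ← Finset.mul_sum]
  rw [← Finset.Ico_succ_right_eq_Icc, Finset.sum_Ico_eq_sum_range]
  have hg : ∑ k ∈ Finset.range t, ζ ^ k = 0 := by
    rw [geom_sum_eq hζ1, hζt, sub_self, zero_div]
  have : ∑ k ∈ Finset.range (Order.succ t - 1), ζ ^ (1 + k) = 0 := by
    simp only [pow_add, ← Finset.mul_sum]
    simp [hg]
  rw [this, mul_zero]

theorem sum_cos_equidistant (β : ℝ) {t : ℕ} {m : ℤ} (hm : m ≠ 0) (hmt : |m| < t) :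
    ∑ j ∈ Finset.Icc 1 t, Real.cos (m * (β + 2 * Real.pi * (j : ℝ) / (t : ℝ))) = 0 := by
  have := congrArg Complex.re (sum_exp_equidistant β hm hmt)
  simpa only [Complex.re_sum, Complex.exp_ofReal_mul_I_re, Complex.zero_re] using this

theorem sum_sin_equidistant (β : ℝ) {t : ℕ} {m : ℤ} (hmt : |m| < t) :
    ∑ j ∈ Finset.Icc 1 t, Real.sin (m * (β + 2 * Real.pi * (j : ℝ) / (t : ℝ))) = 0 := by
  by_cases hm : m = 0
  · simp [hm]
  have := congrArg Complex.im (sum_exp_equidistant β hm hmt)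
  simpa only [Complex.im_sum, Complex.exp_ofReal_mul_I_im, Complex.zero_im] using this

/-- Products become sums of frequencies `k ± k'`, of modulus at most `2d < t`, so only frequency
zero survives. The `1/√2` at index `0` makes all squares average to `1/2`. -/
theorem azimuthal_orthogonal (β : ℝ) {t d : ℕ} (ht : 2 * d + 1 ≤ t) {k k' : ℤ}
    (hk : |k| ≤ d) (hk' : |k'| ≤ d) :
    ∫ φ, azimuthal k φ * azimuthal k' φ ∂(azimuthDesign β t) = if k = k' then 1 / 2 else 0 := by
  have ht0 : (t : ℝ) ≠ 0 := by
    have : 0 < t := by omega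
    exact_mod_cast this.ne'
  rw [integral_azimuthDesign]
  -- Only the sums of `sin (m u_j)` and `cos (m u_j)` with `|m| < t` matter from here on.
  obtain ⟨u, hu⟩ : ∃ u : ℕ → ℝ, ∀ j : ℕ, β + 2 * Real.pi * (j : ℝ) / (t : ℝ) = u j :=
    ⟨_, fun _ => rfl⟩
  simp only [hu]
  rw [abs_le] at hk hk'
  have hs : |k + k'| < t := by rw [abs_lt]; omega
  have hd : |k - k'| < t := by rw [abs_lt]; omega
  have hk1 : |k| < t := by rw [abs_lt]; omega
  have hk1' : |k'| < t := by rw [abs_lt]; omega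
  have hS : ∀ m : ℤ, |m| < t → ∑ j ∈ Finset.Icc 1 t, Real.sin (m * u j) = 0 :=
    fun m hm => by simpa only [hu] using sum_sin_equidistant β hm
  have hC : ∀ m : ℤ, |m| < t → ∑ j ∈ Finset.Icc 1 t, Real.cos (m * u j) =
      if m = 0 then (t : ℝ) else 0 := by
    intro m hm
    split_ifs with h
    · simp [h]
    · simpa only [hu] using sum_cos_equidistant β h hm
  have hcc : ∀ φ : ℝ, Real.cos (k * φ) * Real.cos (k' * φ) =
      (Real.cos (((k - k' : ℤ) : ℝ) * φ) + Real.cos (((k + k' : ℤ) : ℝ) * φ)) / 2 := by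
    intro φ
    push_cast
    rw [sub_mul, add_mul, Real.cos_sub, Real.cos_add]; ring
  have hss : ∀ φ : ℝ, Real.sin (k * φ) * Real.sin (k' * φ) =
      (Real.cos (((k - k' : ℤ) : ℝ) * φ) - Real.cos (((k + k' : ℤ) : ℝ) * φ)) / 2 := by
    intro φ
    push_cast
    rw [sub_mul, add_mul, Real.cos_sub, Real.cos_add]; ring
  have hsc : ∀ φ : ℝ, Real.sin (k * φ) * Real.cos (k' * φ) =
      (Real.sin (((k - k' : ℤ) : ℝ) * φ) + Real.sin (((k + k' : ℤ) : ℝ) * φ)) / 2 := by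
    intro φ
    push_cast
    rw [sub_mul, add_mul, Real.sin_sub, Real.sin_add]; ring
  have hcs : ∀ φ : ℝ, Real.cos (k * φ) * Real.sin (k' * φ) =
      (Real.sin (((k + k' : ℤ) : ℝ) * φ) - Real.sin (((k - k' : ℤ) : ℝ) * φ)) / 2 := by
    intro φ
    push_cast
    rw [sub_mul, add_mul, Real.sin_sub, Real.sin_add]; ring
  unfold azimuthal
  simp only [neg_mul, Real.sin_neg]
  rcases lt_trichotomy k 0 with h | h | h <;> rcases lt_trichotomy k' 0 with h' | h' | h'
  · simp only [h, h', h.not_gt, h'.not_gt, if_true, if_false, neg_mul_neg, hss, ← Finset.sum_div,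
      Finset.sum_sub_distrib, hC _ hs, hC _ hd]
    rw [if_neg (by omega : ¬ k + k' = 0)]
    simp only [sub_eq_zero]
    split_ifs <;> field_simp <;> norm_num
  · subst h'
    simp only [h, h.not_gt, lt_irrefl, h.ne, if_true, if_false, ← Finset.sum_mul,
      Finset.sum_neg_distrib, hS _ hk1]
    simp
  · simp only [h, h', h.not_gt, if_true, if_false, neg_mul, hsc, ← Finset.sum_div,
      Finset.sum_add_distrib, Finset.sum_neg_distrib, hS _ hs, hS _ hd]
    rw [if_neg (by omega)]
    simp
  · subst h
    simp only [h', h'.not_gt, lt_irrefl, h'.ne', if_true, if_false, ← Finset.mul_sum,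
      Finset.sum_neg_distrib, hS _ hk1']
    simp
  · subst h h'
    simp only [lt_irrefl, if_true, if_false]
    rw [div_mul_div_comm, Real.mul_self_sqrt (by norm_num)]
    simp
    field_simp
  · subst h
    simp only [h', lt_irrefl, h'.ne, if_true, if_false, ← Finset.mul_sum, hC _ hk1', h'.ne']
    simp
  · simp only [h, h', h'.not_gt, if_true, if_false, mul_neg, hcs, ← Finset.sum_div,
      Finset.sum_sub_distrib, Finset.sum_neg_distrib, hS _ hs, hS _ hd]
    rw [if_neg (by omega)]
    simp
  · subst h'
    simp only [h, lt_irrefl, h.ne', if_true, if_false, ← Finset.sum_mul, hC _ hk1]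
    simp
  · simp only [h, h', if_true, hcc, ← Finset.sum_div,
      Finset.sum_add_distrib, hC _ hs, hC _ hd]
    rw [if_neg (by omega : ¬ k + k' = 0)]
    simp only [sub_eq_zero]
    split_ifs <;> field_simp <;> norm_num

/-! ## The sum of squares of the harmonics of a level -/

theorem polarFactorConst_succ (N : ℕ) {l b : ℕ} (h : b < l) :
    polarFactorConst N l (b + 1) * ((l - b) * (l + b + N + 1)) =
      (N + 1 + 2 * b) ^ 2 * polarFactorConst N l b := by
  obtain ⟨c, rfl⟩ := Nat.exists_eq_add_of_lt h
  have e1 : b + c + 1 - (b + 1) = c := by omega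
  have e2 : b + c + 1 - b = c + 1 := by omega
  have e3 : b + c + 1 + (b + 1) + N = b + c + 1 + b + N + 1 := by omega
  have hg : Real.Gamma (((2 * (b + 1) + N + 1 : ℕ) : ℝ) / 2) =
      ((2 * b + N + 1 : ℕ) : ℝ) / 2 * Real.Gamma (((2 * b + N + 1 : ℕ) : ℝ) / 2) := by
    rw [← Real.Gamma_add_one (by positivity)]
    congr 1
    push_cast; ring
  unfold polarFactorConst
  rw [e1, e2, e3, hg, Nat.factorial_succ c, Nat.factorial_succ (b + c + 1 + b + N)]
  have := Real.pi_pos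
  push_cast
  field_simp
  ring

/-- The derivative in `x` telescopes. The hypotheses on `e` are the recursion of
`(2b+N)(b+N-1)!/b!`, the shape of the level sums one dimension lower; the step from `e 0` to `e 1`
is separate because the general ratio degenerates there when `N = 0`. -/
theorem sum_gegenbauerChain_sq (N l : ℕ) (e : ℕ → ℝ) (he0 : e 1 = (N + 2) * e 0)
    (he : ∀ b : ℕ, (N + 2 * b + 2) * (b + 2) * e (b + 2) =
      (N + b + 1) * (N + 2 * b + 4) * e (b + 1)) (x : ℝ) :
    ∑ b ∈ Finset.range (l + 1), polarFactorConst N l b * e b *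
      ((1 - x ^ 2) ^ b * gegenbauerChain (((N + 1 : ℕ) : ℝ) / 2) l b x ^ 2) =
    polarFactorConst N l 0 * e 0 * gegenbauerChain (((N + 1 : ℕ) : ℝ) / 2) l 0 1 ^ 2 := by
  set v := gegenbauerChain (((N + 1 : ℕ) : ℝ) / 2) l with hv
  set D : ℕ → ℝ → ℝ := fun b x => polarFactorConst N l b * e b *
    (b * (1 - x ^ 2) ^ (b - 1) * (-(2 * x)) * v b x ^ 2 +
      (1 - x ^ 2) ^ b * (2 * v b x * ((N + 1 + 2 * b) * v (b + 1) x))) with hD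
  have hder : ∀ x, HasDerivAt (fun x => ∑ b ∈ Finset.range (l + 1), polarFactorConst N l b * e b *
      ((1 - x ^ 2) ^ b * v b x ^ 2)) (∑ b ∈ Finset.range (l + 1), D b x) x := by
    intro x
    refine HasDerivAt.fun_sum fun b _ => HasDerivAt.const_mul _ ?_
    have h1 : HasDerivAt (fun x : ℝ => 1 - x ^ 2) (-(2 * x)) x := by
      simpa using ((hasDerivAt_id x).pow 2).const_sub 1
    have h2 := hasDerivAt_gegenbauerChain (((N + 1 : ℕ) : ℝ) / 2) l b x
    refine ((h1.pow b).mul (h2.pow 2)).congr_deriv ?_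
    simp only [Pi.pow_apply, ← hv]
    push_cast
    ring
  -- The derivative of the sum up to `m` is a single product with factor `v (m + 1)`. At `m = l`
  -- this factor is zero.
  have partialSum : ∀ x, ∀ m ≤ l, (N + 2 * m + 2) * ∑ b ∈ Finset.range (m + 1), D b x =
      2 * (N + 1 + 2 * m) * polarFactorConst N l m * e (m + 1) * (m + 1) *
        ((1 - x ^ 2) ^ m * v m x * v (m + 1) x) := by
    intro x m
    induction m with
    | zero =>
      intro _
      simp [hD, he0]
      ring
    | succ m ih =>
      intro hm
      have ihm := ih (by omega)
      have hrec := polarFactorConst_succ N (Nat.lt_of_succ_le hm)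
      have ode := gegenbauerChain_ode (((N + 1 : ℕ) : ℝ) / 2) x l m (by omega)
      have hem := he m
      have hP : ((N : ℝ) + 2 * m + 2) * (N + 1 + 2 * m) ≠ 0 := by positivity
      rw [Finset.sum_range_succ]
      rw [← hv] at ode
      apply mul_left_cancel₀ hP
      simp only [hD, Nat.add_sub_cancel, pow_succ (1 - x ^ 2) m] at ihm ⊢
      push_cast at *
      linear_combination (N + 2 * m + 4) * (N + 1 + 2 * m) * ihm
        - (N + 2 * m + 4) * 2 * e (m + 1) * (m + 1) * ((1 - x ^ 2) ^ m * v m x * v (m + 1) x) * hrec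
        + 2 * (m + 1) * (1 - x ^ 2) ^ m * v (m + 1) x * polarFactorConst N l (m + 1) * e (m + 1)
          * (N + 2 * m + 4) * ode
        - 2 * (N + 3 + 2 * m) * (N + 1 + 2 * m) * polarFactorConst N l (m + 1)
          * ((1 - x ^ 2) ^ m * (1 - x ^ 2) * v (m + 1) x * v (m + 2) x) * hem
  have hzero : ∀ x, ∑ b ∈ Finset.range (l + 1), D b x = 0 := by
    intro x
    have h := partialSum x l le_rfl
    have h0 : v (l + 1) x = 0 := by simp [hv, gegenbauerChain]
    rw [h0, mul_zero, mul_zero] at h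
    exact (mul_eq_zero.mp h).resolve_left (by positivity)
  have hconst := is_const_of_deriv_eq_zero (fun x => (hder x).differentiableAt)
    (fun x => (hder x).deriv.trans (hzero x)) x 1
  -- At `x = 1` every term with `b > 0` contains a power of `1 - x² = 0`.
  rw [hconst, Finset.sum_eq_single 0]
  · simp
  · intro b _ hb
    simp [hb]
  · simp

/-- The constant `K` is independent of both `θ` and `l`, and the right-hand side has the shape
required of `e` for `N + 1`. This makes the induction on the dimension possible. -/
theorem exists_sum_polarFactor_sq (N : ℕ) (e : ℕ → ℝ) (he0 : e 1 = (N + 2) * e 0)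
    (he : ∀ b : ℕ, (N + 2 * b + 2) * (b + 2) * e (b + 2) =
      (N + b + 1) * (N + 2 * b + 4) * e (b + 1)) :
    ∃ K : ℝ, ∀ (l : ℕ) (θ : ℝ), ∑ b ∈ Finset.range (l + 1), polarFactor N l b θ ^ 2 * e b =
      K * ((2 * l + N + 1) * (l + N).factorial / l.factorial) := by
  refine ⟨2 ^ N * Real.Gamma (((N + 1 : ℕ) : ℝ) / 2) ^ 2 / (2 * Real.pi * N.factorial ^ 2) * e 0,
    fun l θ => ?_⟩
  have key := sum_gegenbauerChain_sq N l e he0 he (Real.cos θ)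
  have h1 : ∑ b ∈ Finset.range (l + 1), polarFactor N l b θ ^ 2 * e b =
      ∑ b ∈ Finset.range (l + 1), polarFactorConst N l b * e b *
      ((1 - Real.cos θ ^ 2) ^ b *
        gegenbauerChain (((N + 1 : ℕ) : ℝ) / 2) l b (Real.cos θ) ^ 2) := by
    refine Finset.sum_congr rfl fun b hb => ?_
    have hb' : b ≤ l := by
      have := Finset.mem_range.mp hb
      omega
    have hs : 1 - Real.cos θ ^ 2 = Real.sin θ ^ 2 := by linarith [Real.sin_sq_add_cos_sq θ]
    have ha : ((2 * b + N + 1 : ℕ) : ℝ) / 2 = ((N + 1 : ℕ) : ℝ) / 2 + b := by push_cast; ring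
    rw [polarFactor, gegenbauerChain, if_pos hb', hs, mul_pow, mul_pow,
      Real.sq_sqrt (polarFactorConst_nonneg N l b), ha]
    ring
  have h2 := gegenbauer_eval_at_one N l
  have h3 : gegenbauerChain (((N + 1 : ℕ) : ℝ) / 2) l 0 1 =
      ((N + l).factorial : ℝ) / (N.factorial * l.factorial) := by
    rw [eq_div_iff (by positivity), ← h2]
    simp [gegenbauerChain]
  rw [h1, key, h3, polarFactorConst, add_comm N l]
  have := Real.pi_pos
  simp only [mul_zero, zero_add, Nat.sub_zero, add_zero]
  field_simp

/-! ## The harmonics as products -/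

/-- The indices `(μ_1, …, μ_{m-3}, |μ_{m-2}|)`. -/
def lowerDegree {n : ℕ} (μ : (Fin (n + 1) → ℕ) × ℤ) : Fin (n + 1) → ℕ :=
  Fin.snoc (α := fun _ => ℕ) (fun j : Fin n => μ.1 j.succ) μ.2.natAbs

theorem lowerDegree_castSucc {n : ℕ} (μ : (Fin (n + 1) → ℕ) × ℤ) (j : Fin n) :
    lowerDegree μ j.castSucc = μ.1 j.succ := by
  simp [lowerDegree]

theorem lowerDegree_last {n : ℕ} (μ : (Fin (n + 1) → ℕ) × ℤ) :
    lowerDegree μ (Fin.last n) = μ.2.natAbs := by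
  simp [lowerDegree]

theorem lowerDegree_le {n l : ℕ} {μ : (Fin (n + 1) → ℕ) × ℤ} (h : μ ∈ levelSet n l)
    (j : Fin (n + 1)) : lowerDegree μ j ≤ μ.1 j := by
  obtain ⟨-, h1, h2⟩ := mem_levelSet.mp h
  induction j using Fin.lastCases with
  | last =>
    rw [lowerDegree_last]
    rw [Int.abs_eq_natAbs] at h2
    exact_mod_cast h2
  | cast j =>
    rw [lowerDegree_castSucc]
    exact h1 Fin.castSucc_lt_succ.le

theorem hypersphericalHarmonic_eq {n : ℕ} (μ : (Fin (n + 1) → ℕ) × ℤ)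
    (x : (Fin (n + 1) → ℝ) × ℝ) :
    hypersphericalHarmonic μ x = (-1) ^ μ.2.natAbs / √Real.pi *
      ((∏ j : Fin (n + 1), polarFactor (n - j) (μ.1 j) (lowerDegree μ j) (x.1 j)) *
        azimuthal μ.2 x.2) := by
  rw [hypersphericalHarmonic, legendre_eq_polarFactor, Fin.prod_univ_castSucc]
  simp only [lowerDegree_castSucc, lowerDegree_last, Fin.val_castSucc, Fin.val_last, Nat.sub_self]
  have : ∀ j : Fin n, polarConst n j (μ.1 j.castSucc) (μ.1 j.succ) *
      ((gegenbauer (μ.1 j.succ + ((n + 1 - (j : ℕ) : ℕ) : ℝ) / 2)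
        (μ.1 j.castSucc - μ.1 j.succ)).eval (Real.cos (x.1 j.castSucc)) *
        Real.sin (x.1 j.castSucc) ^ μ.1 j.succ) =
      polarFactor (n - j) (μ.1 j.castSucc) (μ.1 j.succ) (x.1 j.castSucc) :=
    fun j => polarConst_mul_eq_polarFactor j.isLt _
  simp only [this]
  ring

@[fun_prop]
theorem continuous_hypersphericalHarmonic {n : ℕ} (μ : (Fin (n + 1) → ℕ) × ℤ) :
    Continuous (hypersphericalHarmonic μ) := by
  simp only [funext (hypersphericalHarmonic_eq μ)]
  refine continuous_const.mul (Continuous.mul ?_ ?_)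
  · exact continuous_finsetProd _ fun j _ => (continuous_polarFactor _ _ _).comp (by fun_prop)
  · exact (continuous_azimuthal _).comp continuous_snd

/-! ### Sums over a level, by recursion on the dimension -/

theorem sum_levelSet_zero (l : ℕ) (F : (Fin 1 → ℕ) × ℤ → ℝ) :
    ∑ μ ∈ levelSet 0 l, F μ = ∑ k ∈ Finset.Icc (-(l : ℤ)) l, F (fun _ => l, k) := by
  symm
  refine Finset.sum_bij (fun k _ => (fun _ => l, k)) ?_ ?_ ?_ ?_
  · intro k hk
    rw [Finset.mem_Icc] at hk
    exact mem_levelSet.mpr ⟨rfl, fun _ _ _ => le_rfl, abs_le.mpr hk⟩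
  · intro k _ k' _ h
    exact congrArg Prod.snd h
  · rintro ⟨a, k⟩ h
    obtain ⟨h0, -, h2⟩ := mem_levelSet.mp h
    have ha : a = fun _ => l := by
      funext i
      rw [Subsingleton.elim (α := Fin 1) i 0]
      exact h0
    subst ha
    exact ⟨k, Finset.mem_Icc.mpr (abs_le.mp h2), rfl⟩
  · intro k _
    rfl

/-- Removing the top index `l` from a multi-index leaves one of level `b = μ_1 ≤ l` in one dimension
less. -/
theorem sum_levelSet_succ (n l : ℕ) (F : (Fin (n + 2) → ℕ) × ℤ → ℝ) :
    ∑ μ ∈ levelSet (n + 1) l, F μ =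
      ∑ b ∈ Finset.range (l + 1), ∑ μ ∈ levelSet n b,
        F (Fin.cons (α := fun _ => ℕ) l μ.1, μ.2) := by
  rw [Finset.sum_sigma']
  symm
  refine Finset.sum_bij (fun c _ => (Fin.cons (α := fun _ => ℕ) l c.2.1, c.2.2)) ?_ ?_ ?_ ?_
  · rintro ⟨b, μ⟩ h
    rw [Finset.mem_sigma, Finset.mem_range] at h
    obtain ⟨h0, h1, h2⟩ := mem_levelSet.mp h.2
    simp only at h0 h1 h2 h
    refine mem_levelSet.mpr ⟨rfl, ?_, ?_⟩
    · intro i j hij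
      induction i using Fin.cases with
      | zero =>
        induction j using Fin.cases with
        | zero => exact le_rfl
        | succ j =>
          simp only [Fin.cons_zero, Fin.cons_succ]
          have := h1 (Fin.zero_le j)
          omega
      | succ i =>
        induction j using Fin.cases with
        | zero => exact absurd hij (by simp)
        | succ j =>
          simp only [Fin.cons_succ]
          exact h1 (Fin.succ_le_succ_iff.mp hij)
    · rw [← Fin.succ_last]
      simpa using h2
  · rintro ⟨b, μ⟩ h ⟨b', μ'⟩ h' heq
    rw [Finset.mem_sigma] at h h'
    obtain ⟨h0, -, -⟩ := mem_levelSet.mp h.2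
    obtain ⟨h0', -, -⟩ := mem_levelSet.mp h'.2
    simp only [Prod.mk.injEq] at heq h0 h0'
    have h3 : μ = μ' := Prod.ext (Fin.cons_injective2 heq.1).2 heq.2
    subst h3
    rw [h0] at h0'
    subst h0'
    rfl
  · rintro ⟨a, k⟩ h
    obtain ⟨h0, h1, h2⟩ := mem_levelSet.mp h
    simp only at h0 h1 h2
    refine ⟨⟨a 1, (fun j => a j.succ, k)⟩, ?_, ?_⟩
    · rw [Finset.mem_sigma, Finset.mem_range]
      refine ⟨?_, mem_levelSet.mpr ⟨rfl, ?_, ?_⟩⟩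
      · have := h1 (Fin.zero_le 1)
        simp only
        omega
      · intro i j hij
        exact h1 (Fin.succ_le_succ_iff.mpr hij)
      · simpa [Fin.succ_last] using h2
    · refine Prod.ext ?_ rfl
      funext j
      induction j using Fin.cases with
      | zero => exact h0.symm
      | succ j => rfl
  · rintro ⟨b, μ⟩ _
    rfl

/-- The sums of squares of the trigonometric functions of frequency `b`. -/
theorem sum_Icc_azimuthal_sq (l : ℕ) (G : ℕ → ℝ) (φ : ℝ) :
    ∑ k ∈ Finset.Icc (-(l : ℤ)) l, G k.natAbs * azimuthal k φ ^ 2 =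
      ∑ b ∈ Finset.range (l + 1), G b * if b = 0 then 1 / 2 else 1 := by
  induction l with
  | zero => simp [azimuthal]
  | succ l ih =>
    have e : Finset.Icc (-((l + 1 : ℕ) : ℤ)) (l + 1 : ℕ) =
        insert (-((l + 1 : ℕ) : ℤ)) (insert ((l + 1 : ℕ) : ℤ) (Finset.Icc (-(l : ℤ)) l)) := by
      ext k
      simp only [Finset.mem_insert, Finset.mem_Icc]
      omega
    rw [e, Finset.sum_insert, Finset.sum_insert, ih, Finset.sum_range_succ _ (l + 1)]
    · have h1 : (-((l + 1 : ℕ) : ℤ)).natAbs = l + 1 := by omega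
      have h2 : (((l + 1 : ℕ) : ℤ)).natAbs = l + 1 := by omega
      have h3 : ¬ (0 < -((l + 1 : ℕ) : ℤ)) := by omega
      have h4 : -((l + 1 : ℕ) : ℤ) < 0 := by omega
      have h5 : 0 < ((l + 1 : ℕ) : ℤ) := by omega
      have h6 : l + 1 ≠ 0 := by omega
      rw [h1, h2, azimuthal, if_neg h3, if_pos h4, azimuthal, if_pos h5, if_neg h6]
      push_cast
      rw [neg_neg]
      linear_combination G (l + 1) * Real.sin_sq_add_cos_sq (((l : ℝ) + 1) * φ)
    · simp only [Finset.mem_Icc]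
      omega
    · simp only [Finset.mem_insert, Finset.mem_Icc]
      omega

/-- The sum of squares of the harmonics of a level is constant on the sphere. -/
theorem exists_sum_levelSet_sq (n : ℕ) : ∃ K : ℝ, ∀ (l : ℕ) (x : (Fin (n + 1) → ℝ) × ℝ),
    ∑ μ ∈ levelSet n l, hypersphericalHarmonic μ x ^ 2 =
      K * ((2 * l + n + 1) * (l + n).factorial / l.factorial) := by
  have hpi := Real.pi_pos
  induction n with
  | zero =>
    -- These weights are the sums of squares of the trigonometric functions of frequency `b`.
    obtain ⟨K, hK⟩ := exists_sum_polarFactor_sq 0 (fun b => if b = 0 then 1 / 2 else 1)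
      (by norm_num) (by intro b; simp; ring)
    refine ⟨K / Real.pi, fun l x => ?_⟩
    have h := sum_Icc_azimuthal_sq l (fun b => polarFactor 0 l b (x.1 0) ^ 2) x.2
    rw [hK] at h
    rw [sum_levelSet_zero, div_mul_eq_mul_div, ← h, Finset.sum_div]
    refine Finset.sum_congr rfl fun k _ => ?_
    rw [hypersphericalHarmonic_eq, mul_pow, div_pow, ← pow_mul, mul_comm _ 2, pow_mul,
      Real.sq_sqrt hpi.le]
    simp [lowerDegree, Fin.snoc, mul_pow]
    ring
  | succ n ih =>
    obtain ⟨K, hK⟩ := ih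
    -- The weight of `b` is the sum of squares of level `b` one dimension lower, given by the
    -- induction hypothesis.
    obtain ⟨K', hK'⟩ := exists_sum_polarFactor_sq (n + 1)
      (fun l => K * ((2 * l + n + 1) * (l + n).factorial / l.factorial))
      (by
        rw [add_comm 1 n, Nat.factorial_succ]
        push_cast
        simp
        ring)
      (by
        intro b
        rw [show b + 2 + n = b + n + 1 + 1 by ring, show b + 1 + n = b + n + 1 by ring,
          show b + 2 = b + 1 + 1 by ring, Nat.factorial_succ (b + n + 1),
          Nat.factorial_succ (b + 1)]
        push_cast
        field_simp
        ring)
    refine ⟨K', fun l x => ?_⟩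
    have h := hK' l (x.1 0)
    push_cast at h ⊢
    rw [sum_levelSet_succ, add_assoc (2 * (l : ℝ)), ← add_assoc l n 1] at *
    rw [← add_assoc] at h ⊢
    rw [← h]
    refine Finset.sum_congr rfl fun b _ => ?_
    rw [← hK b (fun j => x.1 j.succ, x.2), Finset.mul_sum]
    refine Finset.sum_congr rfl fun μ hμ => ?_
    obtain ⟨h0, -, -⟩ := mem_levelSet.mp hμ
    rw [hypersphericalHarmonic_eq, hypersphericalHarmonic_eq, Fin.prod_univ_succ]
    have e0 : lowerDegree ((Fin.cons (α := fun _ => ℕ) l μ.1 : Fin (n + 2) → ℕ), μ.2) 0 = b := by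
      rw [← Fin.castSucc_zero, lowerDegree_castSucc]
      simpa using h0
    have e1 : ∀ j : Fin (n + 1),
        lowerDegree ((Fin.cons (α := fun _ => ℕ) l μ.1 : Fin (n + 2) → ℕ), μ.2) j.succ =
          lowerDegree μ j := by
      intro j
      induction j using Fin.lastCases with
      | last => rw [Fin.succ_last, lowerDegree_last, lowerDegree_last]
      | cast j =>
        rw [← Fin.castSucc_succ, lowerDegree_castSucc, lowerDegree_castSucc]
        simp
    simp only [e0, e1, Fin.cons_zero, Fin.cons_succ, Fin.val_zero, Fin.val_succ, Nat.sub_zero,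
      Nat.add_sub_add_right]
    ring

/-! ## Optimality criteria -/

section Criteria

variable {κ : Type*} [Fintype κ] [DecidableEq κ]

theorem trace_cfc_eq_sum {C : Matrix κ κ ℝ} (hC : C.IsHermitian) (f : ℝ → ℝ) :
    (cfc f C).trace = ∑ i, f (hC.eigenvalues i) := by
  rw [hC.cfc_eq, Matrix.IsHermitian.cfc, Unitary.conjStarAlgAut_apply, Matrix.trace_mul_cycle]
  simp [Matrix.trace]

/-- The power mean inequality between exponents `p` and `1`. For `0 < p < 1` it is concavity of the
power; for `p < 0` the geometric mean lies between, and the negative exponent `1/p` reverses the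
order. -/
theorem rpow_sum_rpow_le {κ : Type*} [Fintype κ] [Nonempty κ] {p c : ℝ} (hp : p < 1) (hp0 : p ≠ 0) {v : κ → ℝ}
    (hv : ∀ i, 0 < v i) (hsum : ∑ i, v i ≤ Fintype.card κ * c) :
    (∑ i, v i ^ p) ^ (1 / p) ≤ (Fintype.card κ * c ^ p) ^ (1 / p) := by
  have hs : (0 : ℝ) < Fintype.card κ := by exact_mod_cast Fintype.card_pos
  have hvs : 0 < ∑ i, v i := Finset.sum_pos (fun i _ => hv i) Finset.univ_nonempty
  have hc : 0 < c := by
    by_contra h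
    push Not at h
    nlinarith
  have hws : ∑ _i : κ, (1 / (Fintype.card κ : ℝ)) = 1 := by
    simp only [Finset.sum_const, Finset.card_univ, nsmul_eq_mul]
    field_simp
  have hvp : 0 < ∑ i, v i ^ p :=
    Finset.sum_pos (fun i _ => Real.rpow_pos_of_pos (hv i) p) Finset.univ_nonempty
  have hmean : 1 / (Fintype.card κ : ℝ) * ∑ i, v i ≤ c := by
    rw [one_div, inv_mul_le_iff₀ hs]
    exact hsum
  rcases lt_or_gt_of_ne hp0 with h | h
  · rw [one_div, Real.rpow_le_rpow_iff_of_neg hvp (by positivity) (inv_lt_zero.mpr h)]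
    have h1 := Real.geom_mean_le_arith_mean_weighted Finset.univ
      (fun _ : κ => 1 / (Fintype.card κ : ℝ)) v (fun _ _ => by positivity) hws
      (fun i _ => (hv i).le)
    have h2 := Real.geom_mean_le_arith_mean_weighted Finset.univ
      (fun _ : κ => 1 / (Fintype.card κ : ℝ)) (fun i => v i ^ p) (fun _ _ => by positivity) hws
      (fun i _ => (Real.rpow_pos_of_pos (hv i) p).le)
    rw [← Finset.mul_sum] at h1 h2
    have hg : 0 < ∏ i, v i ^ (1 / (Fintype.card κ : ℝ)) :=
      Finset.prod_pos fun i _ => Real.rpow_pos_of_pos (hv i) _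
    have h3 : c ^ p ≤ (∏ i, v i ^ (1 / (Fintype.card κ : ℝ))) ^ p :=
      Real.rpow_le_rpow_of_nonpos hg (h1.trans hmean) h.le
    have h4 : (∏ i, v i ^ (1 / (Fintype.card κ : ℝ))) ^ p =
        ∏ i, (v i ^ p) ^ (1 / (Fintype.card κ : ℝ)) := by
      rw [← Real.finsetProd_rpow _ _ (fun i _ => (Real.rpow_pos_of_pos (hv i) _).le)]
      refine Finset.prod_congr rfl fun i _ => ?_
      rw [← Real.rpow_mul (hv i).le, ← Real.rpow_mul (hv i).le, mul_comm]
    rw [h4] at h3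
    have h5 := h3.trans h2
    rwa [one_div, le_inv_mul_iff₀ hs] at h5
  · refine Real.rpow_le_rpow hvp.le ?_ (by positivity)
    have h1 := (Real.concaveOn_rpow h.le hp.le).le_map_sum (t := Finset.univ)
      (w := fun _ : κ => 1 / (Fintype.card κ : ℝ)) (p := v) (fun _ _ => by positivity) hws
      (fun i _ => (hv i).le)
    simp only [smul_eq_mul, ← Finset.mul_sum] at h1
    have h2 := h1.trans (Real.rpow_le_rpow (by positivity) hmean h.le)
    rwa [one_div, inv_mul_le_iff₀ hs] at h2

/-- All criteria are means of the eigenvalues, bounded by their arithmetic mean: the minimum for `p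
= -∞`, the geometric mean for `p = 0`, a power mean otherwise. -/
theorem kieferCriterion_le_of_trace_le [Nonempty κ] {C : Matrix κ κ ℝ} (hC : C.PosDef) {c : ℝ}
    (htr : C.trace ≤ Fintype.card κ * c) {p : WithBot ℝ} (hp : p < 1) :
    kieferCriterion C p ≤ kieferCriterion (c • (1 : Matrix κ κ ℝ)) p := by
  have hs : (0 : ℝ) < Fintype.card κ := by exact_mod_cast Fintype.card_pos
  have hH := hC.isHermitian
  have hpos := hC.eigenvalues_pos
  have hsum : ∑ i, hH.eigenvalues i ≤ Fintype.card κ * c := by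
    rw [hH.trace_eq_sum_eigenvalues] at htr
    simpa using htr
  have halg : c • (1 : Matrix κ κ ℝ) = algebraMap ℝ _ c := (Algebra.algebraMap_eq_smul_one c).symm
  have hvs : 0 < ∑ i, hH.eigenvalues i := Finset.sum_pos (fun i _ => hpos i) Finset.univ_nonempty
  have hc : 0 < c := by
    by_contra h
    push Not at h
    nlinarith
  induction p using WithBot.recBotCoe with
  | bot =>
    simp only [kieferCriterion]
    rw [halg, spectrum.scalar_eq, csInf_singleton]
    obtain ⟨i, -, hi⟩ := Finset.exists_le_of_sum_le (s := Finset.univ)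
      (f := hH.eigenvalues) (g := fun _ => c) Finset.univ_nonempty (by simpa using hsum)
    exact (csInf_le (Matrix.finite_real_spectrum).bddBelow
      (hH.eigenvalues_mem_spectrum_real i)).trans hi
  | coe p =>
    have hp' : p < 1 := by exact_mod_cast hp
    simp only [kieferCriterion]
    split_ifs with h0
    · have h1 := Real.geom_mean_le_arith_mean_weighted Finset.univ
        (fun _ : κ => 1 / (Fintype.card κ : ℝ)) hH.eigenvalues (fun _ _ => by positivity)
        (by simp) (fun i _ => (hpos i).le)
      rw [← Finset.mul_sum] at h1
      rw [hH.det_eq_prod_eigenvalues, Matrix.det_smul, Matrix.det_one, mul_one, one_div,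
        Real.pow_rpow_inv_natCast hc.le Fintype.card_ne_zero, ← one_div]
      simp only [RCLike.ofReal_real_eq_id, id_eq]
      rw [← Real.finsetProd_rpow _ _ (fun i _ => (hpos i).le)]
      refine h1.trans ?_
      rw [one_div, inv_mul_le_iff₀ hs]
      exact hsum
    · rw [trace_cfc_eq_sum hH, halg, cfc_algebraMap, Algebra.algebraMap_eq_smul_one,
        Matrix.trace_smul, Matrix.trace_one, smul_eq_mul, mul_comm (c ^ p)]
      exact rpow_sum_rpow_le hp' h0 hpos hsum

end Criteria

/-! ### Sums of smallest eigenvalues -/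

section KyFan

/-- Weights in `[0, 1]` of total mass `s` give the least sum when concentrated on the `s` smallest
values. With the `s`-th value `c` as threshold, `v i - c` and the change of weight never have
opposite signs. -/
theorem sum_smallest_le_weighted_sum {N s : ℕ} (hs : 0 < s) (hsN : s ≤ N) {v : Fin N → ℝ}
    (hv : Monotone v) {w : Fin N → ℝ} (hw0 : ∀ i, 0 ≤ w i) (hw1 : ∀ i, w i ≤ 1)
    (hw : ∑ i, w i = s) :
    (∑ i : Fin N, if (i : ℕ) < s then v i else 0) ≤ ∑ i, v i * w i := by
  set c := v ⟨s - 1, by omega⟩ with hc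
  have hcard : (∑ i : Fin N, if (i : ℕ) < s then (1 : ℝ) else 0) = s := by
    rw [← Finset.sum_range (fun i => if i < s then (1 : ℝ) else 0), ← Finset.sum_filter]
    have : (Finset.range N).filter (· < s) = Finset.range s := by
      ext i
      simp only [Finset.mem_filter, Finset.mem_range]
      omega
    simp [this]
  have key : 0 ≤ ∑ i, (v i - c) * (w i - if (i : ℕ) < s then 1 else 0) := by
    refine Finset.sum_nonneg fun i _ => ?_
    split_ifs with h
    · have : v i ≤ c := hv (by rw [Fin.le_def]; simp only; omega)
      nlinarith [hw1 i]
    · have : c ≤ v i := hv (by rw [Fin.le_def]; simp only; omega)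
      nlinarith [hw0 i]
  have e : ∑ i, (v i - c) * (w i - if (i : ℕ) < s then 1 else 0) =
      ∑ i, v i * w i - (∑ i : Fin N, if (i : ℕ) < s then v i else 0) -
        c * (∑ i, w i - ∑ i : Fin N, if (i : ℕ) < s then (1 : ℝ) else 0) := by
    rw [← Finset.sum_sub_distrib, ← Finset.sum_sub_distrib, Finset.mul_sum,
      ← Finset.sum_sub_distrib]
    refine Finset.sum_congr rfl fun i _ => ?_
    split_ifs <;> ring
  rw [e, hw, hcard] at key
  linarith

variable {ι κ : Type*} [Fintype ι] [DecidableEq ι] [Fintype κ]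

theorem diag_eq_sum_eigenvalues {A : Matrix ι ι ℝ} (hA : A.IsHermitian) (a : ι) :
    A a a = ∑ i, hA.eigenvalues i * (hA.eigenvectorBasis i a) ^ 2 := by
  conv_lhs => rw [hA.spectral_theorem]
  rw [Unitary.conjStarAlgAut_apply, Matrix.mul_apply]
  refine Finset.sum_congr rfl fun i _ => ?_
  rw [Matrix.mul_diagonal, Matrix.star_apply, Matrix.IsHermitian.eigenvectorUnitary_apply]
  simp
  ring

theorem sum_eigenvectorBasis_sq_index {A : Matrix ι ι ℝ} (hA : A.IsHermitian) (a : ι) :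
    ∑ i, (hA.eigenvectorBasis i a) ^ 2 = 1 := by
  have h := congrFun (congrFun (Unitary.coe_mul_star_self hA.eigenvectorUnitary) a) a
  rw [Unitary.coe_star, Matrix.mul_apply, Matrix.one_apply_eq] at h
  rw [← h]
  refine Finset.sum_congr rfl fun i _ => ?_
  rw [Matrix.star_apply, Matrix.IsHermitian.eigenvectorUnitary_apply]
  simp [sq]

theorem sum_eigenvectorBasis_sq_coord {A : Matrix ι ι ℝ} (hA : A.IsHermitian) (i : ι) :
    ∑ a, (hA.eigenvectorBasis i a) ^ 2 = 1 := by
  have h := hA.eigenvectorBasis.orthonormal.1 i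
  rw [EuclideanSpace.norm_eq, Real.sqrt_eq_one] at h
  simpa using h

/-- Ky Fan's inequality for coordinate subspaces. -/
theorem sumSmallestEigenvalues_le_sum_diag [Nonempty κ] {A : Matrix ι ι ℝ} (hA : A.IsHermitian)
    {e : κ → ι} (he : Function.Injective e) :
    sumSmallestEigenvalues hA (Fintype.card κ) ≤ ∑ b, A (e b) (e b) := by
  set u := hA.eigenvectorBasis with hu
  let E : Fin (Fintype.card ι) ≃ ι := Fintype.equivOfCardEq (Fintype.card_fin _)
  -- This reindexing lists the eigenvalues in nondecreasing order.
  let R : Fin (Fintype.card ι) ≃ ι := Fin.revPerm.trans E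
  have hev : ∀ i, hA.eigenvalues (R i) = hA.eigenvalues₀ i.rev := by
    intro i
    simp [Matrix.IsHermitian.eigenvalues, R, E]
  have h1 := sum_smallest_le_weighted_sum (s := Fintype.card κ) (N := Fintype.card ι)
    Fintype.card_pos (Fintype.card_le_of_injective e he)
    (v := fun i => hA.eigenvalues₀ i.rev)
    (fun i j h => hA.eigenvalues₀_antitone (Fin.rev_le_rev.mpr h))
    -- The weight is the squared length of the projection of an eigenvector to the coordinate
    -- subspace: at most `1` for each eigenvector, and the dimension of the subspace in total.
    (w := fun i => ∑ b, u (R i) (e b) ^ 2)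
    (fun i => Finset.sum_nonneg fun b _ => sq_nonneg _)
    (fun i => by
      rw [← sum_eigenvectorBasis_sq_coord hA (R i),
        ← Finset.sum_image (s := Finset.univ) (g := e) (f := fun a => u (R i) a ^ 2)
          (fun _ _ _ _ h => he h)]
      exact Finset.sum_le_sum_of_subset_of_nonneg (Finset.subset_univ _)
        fun _ _ _ => sq_nonneg _)
    (by
      rw [Finset.sum_comm]
      have : ∀ b, ∑ i, u (R i) (e b) ^ 2 = 1 := fun b => by
        rw [Equiv.sum_comp R (fun i => u i (e b) ^ 2)]
        exact sum_eigenvectorBasis_sq_index hA (e b)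
      simp [this])
  refine h1.trans (le_of_eq ?_)
  simp only [← hev]
  rw [Equiv.sum_comp R (fun i => hA.eigenvalues i * ∑ b, u i (e b) ^ 2)]
  simp only [Finset.mul_sum]
  rw [Finset.sum_comm]
  exact Finset.sum_congr rfl fun b _ => (diag_eq_sum_eigenvalues hA (e b)).symm

theorem sumSmallestEigenvalues_smul_one {A : Matrix ι ι ℝ} (hA : A.IsHermitian) {c : ℝ}
    (h : A = c • 1) {s : ℕ} (hs : s ≤ Fintype.card ι) : sumSmallestEigenvalues hA s = s * c := by
  have hev : ∀ i, hA.eigenvalues₀ i = c := by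
    intro i
    let E : Fin (Fintype.card ι) ≃ ι := Fintype.equivOfCardEq (Fintype.card_fin _)
    have h1 : hA.eigenvalues (E i) ∈ spectrum ℝ A := hA.eigenvalues_mem_spectrum_real _
    have : Nonempty ι := ⟨E i⟩
    have h2 : spectrum ℝ A = {c} := by
      rw [h, ← Algebra.algebraMap_eq_smul_one, spectrum.scalar_eq]
    rw [h2, Set.mem_singleton_iff] at h1
    simpa [Matrix.IsHermitian.eigenvalues, E] using h1
  unfold sumSmallestEigenvalues
  simp only [hev]
  rw [← Finset.sum_range (fun i => if i < s then c else 0), ← Finset.sum_filter]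
  have : (Finset.range (Fintype.card ι)).filter (· < s) = Finset.range s := by
    ext i
    simp only [Finset.mem_filter, Finset.mem_range]
    omega
  simp [this]

end KyFan

/-! ## Optimality of designs with a scalar information matrix -/

section Optimality

variable {X ι κ : Type*} [MeasurableSpace X] [TopologicalSpace X] [OpensMeasurableSpace X]

theorem IsDesign.integrable_mul {S : Set X} (hS : IsCompact S) {f : ι → X → ℝ}
    (hf : ∀ a, Continuous (f a)) {η : Measure X} (hη : IsDesign S η) (a b : ι) :
    Integrable (fun x => f a x * f b x) η := by
  have := hη.isProbabilityMeasure
  have hcont : Continuous fun x => f a x * f b x := (hf a).mul (hf b)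
  obtain ⟨B, hB⟩ := hS.exists_bound_of_continuousOn hcont.continuousOn
  refine Integrable.of_bound hcont.measurable.aestronglyMeasurable B ?_
  filter_upwards [hη.ae_mem] with x hx using hB x hx

variable [Fintype ι] [Fintype κ]

theorem IsDesign.infoMatrix_posSemidef {S : Set X} (hS : IsCompact S) {f : ι → X → ℝ}
    (hf : ∀ a, Continuous (f a)) {η : Measure X} (hη : IsDesign S η) :
    (infoMatrix f η).PosSemidef := by
  refine Matrix.PosSemidef.of_dotProduct_mulVec_nonneg (infoMatrix_isHermitian f η) fun v => ?_
  have e : star v ⬝ᵥ infoMatrix f η *ᵥ v = ∫ x, (∑ a, v a * f a x) ^ 2 ∂η := by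
    have h1 : ∀ x, (∑ a, v a * f a x) ^ 2 = ∑ a, ∑ b, v a * v b * (f a x * f b x) := by
      intro x
      rw [sq, Finset.sum_mul_sum]
      exact Finset.sum_congr rfl fun a _ => Finset.sum_congr rfl fun b _ => by ring
    simp only [h1]
    rw [integral_finsetSum _ fun a _ => integrable_finsetSum _ fun b _ =>
      (hη.integrable_mul hS hf a b).const_mul _]
    simp only [dotProduct, Matrix.mulVec, Finset.mul_sum]
    refine Finset.sum_congr rfl fun a _ => ?_
    rw [integral_finsetSum _ fun b _ => (hη.integrable_mul hS hf a b).const_mul _]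
    refine Finset.sum_congr rfl fun b _ => ?_
    rw [integral_const_mul, infoMatrix]
    simp
    ring
  rw [e]
  exact integral_nonneg fun x => sq_nonneg _

/-- This makes the upper bound in both optimality proofs independent of the competing design. -/
theorem IsDesign.sum_diag_infoMatrix {ι : Type*} {S : Set X} (hS : IsCompact S)
    {f : ι → X → ℝ}
    (hf : ∀ a, Continuous (f a)) {η : Measure X} (hη : IsDesign S η) {e : κ → ι} {T : ℝ}
    (hT : ∀ x, ∑ b, f (e b) x ^ 2 = T) : ∑ b, infoMatrix f η (e b) (e b) = T := by
  have := hη.isProbabilityMeasure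
  simp only [infoMatrix, Matrix.of_apply]
  rw [← integral_finsetSum _ fun b _ => hη.integrable_mul hS hf (e b) (e b)]
  simp only [← sq, hT]
  simp

variable [DecidableEq ι] [DecidableEq κ]

theorem exists_eq_infoMatrix_mul {X ι κ : Type*} [MeasurableSpace X] [Fintype ι] [Fintype κ]
    [DecidableEq κ] {f : ι → X → ℝ} {K : Matrix ι κ ℝ} {η : Measure X} (h : IsEstimable f K η) : ∃ L : Matrix ι κ ℝ, K = infoMatrix f η * L := by
  choose v hv using fun b : κ => h ⟨Pi.single b 1, rfl⟩
  refine ⟨Matrix.of fun a b => v b a, ?_⟩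
  ext a b
  have := congrFun (hv b) a
  simp only [Matrix.mulVecLin_apply, Matrix.mulVec_single_one] at this
  simpa [Matrix.mul_apply, Matrix.mulVec, dotProduct] using this.symm

/-- If `Kᵀ K = 1` then `C_K(η)` is positive definite and bounded by `Kᵀ M(η) K`. -/
theorem coefMatrix_posDef_and_trace_le {X : Type*} [MeasurableSpace X] {f : ι → X → ℝ}
    {K : Matrix ι κ ℝ} (hK : Kᵀ * K = 1) {η : Measure X}
    (hM : (infoMatrix f η).PosSemidef) (h : IsEstimable f K η) :
    (coefMatrix f K η).PosDef ∧
      (coefMatrix f K η).trace ≤ (Kᵀ * infoMatrix f η * K).trace := by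
  obtain ⟨L, hL⟩ := exists_eq_infoMatrix_mul h
  have hG := mul_generalizedInverse_mul (infoMatrix f η)
  have hMt : (infoMatrix f η)ᵀ = infoMatrix f η := by
    simpa [Matrix.IsHermitian, Matrix.conjTranspose_eq_transpose_of_trivial]
      using infoMatrix_isHermitian f η
  unfold coefMatrix
  generalize generalizedInverse (infoMatrix f η) = G at *
  generalize infoMatrix f η = M at *
  have hA : Kᵀ * G * K = Lᵀ * M * L := by
    rw [hL, Matrix.transpose_mul, hMt]
    have : Lᵀ * M * G * (M * L) = Lᵀ * (M * G * M) * L := by simp only [Matrix.mul_assoc]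
    rw [this, hG]
  rw [hA]
  have hApd : (Lᵀ * M * L).PosDef := by
    have hps : (Lᵀ * M * L).PosSemidef := by
      have := hM.conjTranspose_mul_mul_same L
      rwa [Matrix.conjTranspose_eq_transpose_of_trivial] at this
    refine (Matrix.PosSemidef.posDef_iff_isUnit hps).mpr ?_
    rw [← Matrix.mulVec_injective_iff_isUnit, ← Matrix.coe_mulVecLin, ← LinearMap.ker_eq_bot,
      LinearMap.ker_eq_bot']
    intro v hv
    rw [Matrix.mulVecLin_apply] at hv
    -- For positive semidefinite `M`, a vector with vanishing quadratic form lies in the kernel.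
    have h1 : M *ᵥ (L *ᵥ v) = 0 := by
      rw [← hM.dotProduct_mulVec_zero_iff]
      have : star (L *ᵥ v) ⬝ᵥ M *ᵥ L *ᵥ v = v ⬝ᵥ (Lᵀ * M * L) *ᵥ v := by
        rw [star_trivial, ← Matrix.mulVec_mulVec, ← Matrix.mulVec_mulVec,
          Matrix.dotProduct_mulVec v, Matrix.vecMul_transpose]
      rw [this, hv, dotProduct_zero]
    have h2 : K *ᵥ v = 0 := by rw [hL, ← Matrix.mulVec_mulVec, h1]
    have h3 : (Kᵀ * K) *ᵥ v = 0 := by rw [← Matrix.mulVec_mulVec, h2, Matrix.mulVec_zero]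
    rwa [hK, Matrix.one_mulVec] at h3
  refine ⟨hApd.inv, ?_⟩
  set A := Lᵀ * M * L with hAdef
  have hdet : IsUnit A.det := (Matrix.isUnit_iff_isUnit_det A).mp hApd.isUnit
  have hAt : A⁻¹ᵀ = A⁻¹ := by
    have := hApd.inv.isHermitian
    rwa [Matrix.IsHermitian, Matrix.conjTranspose_eq_transpose_of_trivial] at this
  -- With this choice `M L = K` and `Kᵀ K = 1` collapse the semidefinite form to `Kᵀ M K - A⁻¹`,
  -- which is the Loewner bound.
  have hps := hM.conjTranspose_mul_mul_same (K - L * A⁻¹)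
  rw [Matrix.conjTranspose_eq_transpose_of_trivial] at hps
  have hexp : (K - L * A⁻¹)ᵀ * M * (K - L * A⁻¹) = Kᵀ * M * K - A⁻¹ := by
    have hML : M * L = K := hL.symm
    have hLM : Lᵀ * M = Kᵀ := by rw [hL, Matrix.transpose_mul, hMt]
    have hLK : Lᵀ * K = A := by rw [hL, ← Matrix.mul_assoc]
    have e1 : M * (K - L * A⁻¹) = M * K - K * A⁻¹ := by
      rw [Matrix.mul_sub, ← Matrix.mul_assoc, hML]
    rw [Matrix.mul_assoc, e1, Matrix.transpose_sub, Matrix.transpose_mul, hAt, Matrix.sub_mul,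
      Matrix.mul_sub, Matrix.mul_sub, ← Matrix.mul_assoc Kᵀ K, hK, Matrix.one_mul,
      Matrix.mul_assoc A⁻¹ Lᵀ (M * K), ← Matrix.mul_assoc Lᵀ M K, hLM, hK, Matrix.mul_one,
      Matrix.mul_assoc A⁻¹ Lᵀ, ← Matrix.mul_assoc Lᵀ K, hLK, Matrix.mul_nonsing_inv A hdet,
      Matrix.mul_one, sub_self, sub_zero, ← Matrix.mul_assoc]
  rw [hexp] at hps
  have := hps.trace_nonneg
  rw [Matrix.trace_sub] at this
  linarith

theorem transpose_submatrix_one_mul {ι κ : Type*} [Fintype ι] [DecidableEq ι] [DecidableEq κ]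
    {e : κ → ι} (he : Function.Injective e) :
    ((1 : Matrix ι ι ℝ).submatrix id e)ᵀ * (1 : Matrix ι ι ℝ).submatrix id e = 1 := by
  ext a b
  simp [Matrix.mul_apply, Matrix.one_apply, he.eq_iff, eq_comm]

theorem trace_submatrix_one {ι κ : Type*} [Fintype ι] [Fintype κ] [DecidableEq ι]
    (M : Matrix ι ι ℝ) (e : κ → ι) :
    (((1 : Matrix ι ι ℝ).submatrix id e)ᵀ * M * (1 : Matrix ι ι ℝ).submatrix id e).trace =
      ∑ b, M (e b) (e b) := by
  simp [Matrix.trace, Matrix.mul_apply, Matrix.one_apply]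

theorem isPhiOptimal_of_infoMatrix_eq_smul_one [Nonempty κ] {S : Set X} (hS : IsCompact S)
    {f : ι → X → ℝ} (hf : ∀ a, Continuous (f a)) {e : κ → ι} (he : Function.Injective e)
    {c : ℝ} (hc : 0 < c) (hsum : ∀ x, ∑ b, f (e b) x ^ 2 = Fintype.card κ * c)
    {ξ : Measure X} (hξ : IsDesign S ξ) (hM : infoMatrix f ξ = c • 1) {p : WithBot ℝ}
    (hp : p < 1) : IsPhiOptimal S f ((1 : Matrix ι ι ℝ).submatrix id e) p ξ := by
  set K := (1 : Matrix ι ι ℝ).submatrix id e with hK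
  have hKK : Kᵀ * K = 1 := transpose_submatrix_one_mul he
  have hest : IsEstimable f K ξ := by
    rintro _ ⟨v, rfl⟩
    refine ⟨c⁻¹ • K *ᵥ v, ?_⟩
    rw [hM, Matrix.mulVecLin_apply, Matrix.smul_mulVec, Matrix.one_mulVec, smul_smul,
      mul_inv_cancel₀ hc.ne', one_smul, Matrix.mulVecLin_apply]
  have hcoef : coefMatrix f K ξ = c • 1 := by
    rw [coefMatrix_eq f K ξ hest (c⁻¹ • 1)]
    · rw [Matrix.mul_smul, Matrix.mul_one, Matrix.smul_mul, hKK]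
      refine Matrix.inv_eq_left_inv ?_
      rw [Matrix.smul_mul, Matrix.one_mul, smul_smul, mul_inv_cancel₀ hc.ne', one_smul]
    · rw [hM]
      simp [smul_smul, hc.ne']
  refine ⟨hξ, hest, fun η hη hη' => ?_⟩
  obtain ⟨h1, h2⟩ := coefMatrix_posDef_and_trace_le hKK (hη.infoMatrix_posSemidef hS hf) hη'
  rw [hcoef]
  refine kieferCriterion_le_of_trace_le h1 (h2.trans ?_) hp
  rw [hK, trace_submatrix_one, hη.sum_diag_infoMatrix hS hf hsum]

theorem isPhiEOptimal_of_infoMatrix_eq_smul_one {κ : Type*} [Fintype κ] [Nonempty κ] {S : Set X}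
    (hS : IsCompact S)
    {f : ι → X → ℝ} (hf : ∀ a, Continuous (f a)) {e : κ → ι} (he : Function.Injective e)
    {c : ℝ} (hsum : ∀ x, ∑ b, f (e b) x ^ 2 = Fintype.card κ * c)
    {ξ : Measure X} (hξ : IsDesign S ξ) (hM : infoMatrix f ξ = c • 1) :
    IsPhiEOptimal S f (Fintype.card κ) ξ := by
  refine ⟨hξ, fun η hη => ?_⟩
  rw [sumSmallestEigenvalues_smul_one _ hM (Fintype.card_le_of_injective e he),
    ← hη.sum_diag_infoMatrix hS hf hsum]
  exact sumSmallestEigenvalues_le_sum_diag _ he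

end Optimality

/-! ## The product designs -/

theorem angleSpace_eq (n : ℕ) : angleSpace n =
    (Set.univ.pi fun _ : Fin (n + 1) => Set.Icc 0 Real.pi) ×ˢ Set.Icc (-Real.pi) Real.pi := by
  ext x
  simp only [angleSpace, Set.mem_prod, Set.mem_univ_pi, Set.mem_ofPred_eq]

theorem isCompact_angleSpace (n : ℕ) : IsCompact (angleSpace n) := by
  rw [angleSpace_eq]
  exact (isCompact_univ_pi fun _ => isCompact_Icc).prod isCompact_Icc

theorem sum_smul_dirac_apply {κ : Type*} (s : Finset κ) (w : κ → ℝ) (y : κ → ℝ)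
    (hw : ∀ j ∈ s, 0 ≤ w j) (hsum : ∑ j ∈ s, w j = 1) {A : Set ℝ} (hA : MeasurableSet A)
    (hy : ∀ j ∈ s, y j ∈ A) : (∑ j ∈ s, ENNReal.ofReal (w j) • Measure.dirac (y j)) A = 1 := by
  rw [Measure.finsetSum_apply, ← ENNReal.ofReal_one, ← hsum, ENNReal.ofReal_sum_of_nonneg hw]
  refine Finset.sum_congr rfl fun j hj => ?_
  rw [Measure.smul_apply, Measure.dirac_apply' _ hA, Set.indicator_of_mem (hy j hj)]
  simp

theorem IsQuadrature.polarDesign_apply {a : ℝ → ℝ} {z r : ℕ} {x w : Fin r → ℝ}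
    (h : IsQuadrature a z x w) {A : Set ℝ} (hA : MeasurableSet A)
    (hx : ∀ j, Real.arccos (x j) ∈ A) : polarDesign x w A = 1 :=
  sum_smul_dirac_apply _ _ _ (fun j _ => (h.pos j).le) h.sum_eq_one hA fun j _ => hx j

theorem azimuthDesign_apply (β : ℝ) {t : ℕ} (ht : 0 < t) {A : Set ℝ} (hA : MeasurableSet A)
    (hx : ∀ j ∈ Finset.Icc 1 t, β + 2 * Real.pi * (j : ℝ) / (t : ℝ) ∈ A) :
    azimuthDesign β t A = 1 := by
  have ht' : (t : ℝ) ≠ 0 := by exact_mod_cast ht.ne'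
  refine sum_smul_dirac_apply _ (fun _ => 1 / (t : ℝ)) _ (fun _ _ => by positivity) ?_ hA hx
  simp [ht']

theorem azimuth_mem_Icc {β : ℝ} {t : ℕ}
    (hβ : β ∈ Set.Ioc (-(((t : ℝ) + 1) / t * Real.pi)) (-Real.pi)) {j : ℕ}
    (hj : j ∈ Finset.Icc 1 t) :
    β + 2 * Real.pi * (j : ℝ) / (t : ℝ) ∈ Set.Icc (-Real.pi) Real.pi := by
  obtain ⟨h1, h2⟩ := Finset.mem_Icc.mp hj
  have ht : (0 : ℝ) < t := by
    have : 0 < t := by omega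
    exact_mod_cast this
  have hpi := Real.pi_pos
  have h1' : (1 : ℝ) ≤ j := by exact_mod_cast h1
  have h2' : (j : ℝ) ≤ t := by exact_mod_cast h2
  -- The first node is at least `β + 2π/t`, and `β > -π - π/t` keeps it above `-π`; the last node is
  -- `β + 2π ≤ π`.
  have h3 : Real.pi / t ≤ Real.pi * (j : ℝ) / t := by gcongr; nlinarith
  have h4 : Real.pi * (j : ℝ) / t ≤ Real.pi := by
    rw [div_le_iff₀ ht]
    gcongr
  have e1 : ((t : ℝ) + 1) / t * Real.pi = Real.pi + Real.pi / t := by field_simp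
  have e2 : 2 * Real.pi * (j : ℝ) / t = 2 * (Real.pi * (j : ℝ) / t) := by ring
  have h5 : 0 < Real.pi / t := by positivity
  rw [Set.mem_Ioc, e1] at hβ
  rw [e2]
  constructor <;> linarith [hβ.1, hβ.2]

theorem isDesign_productDesign {n d r t : ℕ} (ht : 0 < t) {x w : Fin (n + 1) → Fin r → ℝ}
    (hquad : ∀ i : Fin (n + 1), IsQuadrature (polarWeight n i) (2 * d) (x i) (w i))
    {β : ℝ} (hβ : β ∈ Set.Ioc (-(((t : ℝ) + 1) / t * Real.pi)) (-Real.pi)) :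
    IsDesign (angleSpace n) (productDesign x w β t) := by
  have hP : ∀ i, IsProbabilityMeasure (polarDesign (x i) (w i)) := fun i =>
    ⟨(hquad i).polarDesign_apply MeasurableSet.univ fun _ => Set.mem_univ _⟩
  have hA : IsProbabilityMeasure (azimuthDesign β t) :=
    ⟨azimuthDesign_apply β ht MeasurableSet.univ fun _ _ => Set.mem_univ _⟩
  have hprob : IsProbabilityMeasure (productDesign x w β t) := by
    unfold productDesign
    infer_instance
  refine ⟨hprob, ?_⟩
  refine (mem_ae_iff_prob_eq_one (isCompact_angleSpace n).measurableSet).mpr ?_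
  rw [angleSpace_eq, productDesign, Measure.prod_prod, Measure.pi_pi,
    azimuthDesign_apply β ht measurableSet_Icc fun j hj => azimuth_mem_Icc hβ hj]
  simp only [fun i => (hquad i).polarDesign_apply measurableSet_Icc
    fun j => ⟨Real.arccos_nonneg (x i j), Real.arccos_le_pi (x i j)⟩]
  simp

theorem solidAngle_eq (n : ℕ) : solidAngle n =
    (∏ j : Fin (n + 1), ∫ θ in (0 : ℝ)..Real.pi, Real.sin θ ^ (n - j + 1)) * (2 * Real.pi) := by
  have hpi := Real.pi_pos
  have h := setIntegral_prod_mul (μ := (volume : Measure (Fin (n + 1) → ℝ)))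
    (ν := (volume : Measure ℝ))
    (fun x => ∏ j : Fin (n + 1), Real.sin (x j) ^ (n + 1 - (j : ℕ) : ℕ)) (fun _ => (1 : ℝ))
    (Set.univ.pi fun _ : Fin (n + 1) => Set.Icc 0 Real.pi) (Set.Icc (-Real.pi) Real.pi)
  simp only [mul_one] at h
  rw [solidAngle, angleSpace_eq, Measure.volume_eq_prod, h, volume_pi, Measure.restrict_pi_pi,
    integral_fintype_prod_eq_prod
      (fun (j : Fin (n + 1)) (θ : ℝ) => Real.sin θ ^ (n + 1 - (j : ℕ) : ℕ))]
  congr 1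
  · refine Finset.prod_congr rfl fun j _ => ?_
    rw [intervalIntegral.integral_of_le hpi.le, integral_Icc_eq_integral_Ioc,
      show n + 1 - (j : ℕ) = n - j + 1 by omega]
  · simp
    rw [max_eq_left (by linarith)]
    ring

theorem solidAngle_pos (n : ℕ) : 0 < solidAngle n := by
  rw [solidAngle_eq]
  exact mul_pos (Finset.prod_pos fun j _ => integral_sin_pow_pos _) (by positivity)

theorem integral_productDesign {n r t : ℕ} (ht : 0 < t) {x w : Fin (n + 1) → Fin r → ℝ}
    {z : ℕ} (hquad : ∀ i : Fin (n + 1), IsQuadrature (polarWeight n i) z (x i) (w i)) (β : ℝ)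
    (f : Fin (n + 1) → ℝ → ℝ) (g : ℝ → ℝ) :
    ∫ y, (∏ j, f j (y.1 j)) * g y.2 ∂(productDesign x w β t) =
      (∏ j, ∑ i, w j i * f j (Real.arccos (x j i))) * ∫ φ, g φ ∂(azimuthDesign β t) := by
  have hP : ∀ i, IsProbabilityMeasure (polarDesign (x i) (w i)) := fun i =>
    ⟨(hquad i).polarDesign_apply MeasurableSet.univ fun _ => Set.mem_univ _⟩
  have hA : IsProbabilityMeasure (azimuthDesign β t) :=
    ⟨azimuthDesign_apply β ht MeasurableSet.univ fun _ _ => Set.mem_univ _⟩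
  rw [productDesign, integral_prod_mul (fun y : Fin (n + 1) → ℝ => ∏ j, f j (y j)) g,
    integral_fintype_prod_eq_prod f]
  congr 1
  exact Finset.prod_congr rfl fun j _ =>
    integral_polarDesign _ _ (fun i => ((hquad j).pos i).le) _

theorem le_of_mem_levelSet {n l : ℕ} {μ : (Fin (n + 1) → ℕ) × ℤ} (h : μ ∈ levelSet n l)
    (j : Fin (n + 1)) : μ.1 j ≤ l := by
  obtain ⟨h0, h1, -⟩ := mem_levelSet.mp h
  exact h0 ▸ h1 (Fin.zero_le j)

theorem abs_le_of_mem_levelSet {n l : ℕ} {μ : (Fin (n + 1) → ℕ) × ℤ} (h : μ ∈ levelSet n l) :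
    |μ.2| ≤ l := by
  have h1 := le_of_mem_levelSet h (Fin.last n)
  have h2 := (mem_levelSet.mp h).2.2
  omega

/-- The harmonics of level at most `d` are orthogonal under the product design. -/
theorem integral_hypersphericalHarmonic_mul {n d r t : ℕ} (ht : 2 * d + 1 ≤ t)
    {x w : Fin (n + 1) → Fin r → ℝ}
    (hquad : ∀ i : Fin (n + 1), IsQuadrature (polarWeight n i) (2 * d) (x i) (w i)) (β : ℝ)
    {l l' : ℕ} (hl : l ≤ d) (hl' : l' ≤ d) {μ μ' : (Fin (n + 1) → ℕ) × ℤ}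
    (hμ : μ ∈ levelSet n l) (hμ' : μ' ∈ levelSet n l') :
    ∫ y, hypersphericalHarmonic μ y * hypersphericalHarmonic μ' y ∂(productDesign x w β t) =
      if μ = μ' then 1 / solidAngle n else 0 := by
  have hpi := Real.pi_pos
  have e : ∀ y : (Fin (n + 1) → ℝ) × ℝ, hypersphericalHarmonic μ y * hypersphericalHarmonic μ' y =
      ((-1) ^ μ.2.natAbs * (-1) ^ μ'.2.natAbs / Real.pi) *
      ((∏ j : Fin (n + 1), polarFactor (n - j) (μ.1 j) (lowerDegree μ j) (y.1 j) *
        polarFactor (n - j) (μ'.1 j) (lowerDegree μ' j) (y.1 j)) *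
        (azimuthal μ.2 y.2 * azimuthal μ'.2 y.2)) := by
    intro y
    rw [hypersphericalHarmonic_eq, hypersphericalHarmonic_eq, Finset.prod_mul_distrib]
    rw [mul_mul_mul_comm, div_mul_div_comm, Real.mul_self_sqrt hpi.le]
    ring
  have hint := integral_productDesign (by omega : 0 < t) hquad β
    (fun (j : Fin (n + 1)) θ => polarFactor (n - j) (μ.1 j) (lowerDegree μ j) θ *
      polarFactor (n - j) (μ'.1 j) (lowerDegree μ' j) θ)
    (fun φ => azimuthal μ.2 φ * azimuthal μ'.2 φ)
  beta_reduce at hint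
  simp only [e]
  rw [integral_const_mul, hint,
    azimuthal_orthogonal β ht ((abs_le_of_mem_levelSet hμ).trans (by exact_mod_cast hl))
      ((abs_le_of_mem_levelSet hμ').trans (by exact_mod_cast hl'))]
  have horth : ∀ j : Fin (n + 1), lowerDegree μ j = lowerDegree μ' j →
      (∫ θ in (0 : ℝ)..Real.pi, Real.sin θ ^ (n - j + 1)) *
      ∑ i, w j i * (polarFactor (n - j) (μ.1 j) (lowerDegree μ j) (Real.arccos (x j i)) *
        polarFactor (n - j) (μ'.1 j) (lowerDegree μ' j) (Real.arccos (x j i))) =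
      if μ.1 j = μ'.1 j then 1 else 0 := by
    intro j hj
    rw [← hj]
    exact (hquad j).polarFactor_orthonormal (lowerDegree_le hμ j) (hj ▸ lowerDegree_le hμ' j)
      ((le_of_mem_levelSet hμ j).trans hl) ((le_of_mem_levelSet hμ' j).trans hl')
  have hJ : ∀ j : Fin (n + 1), (∫ θ in (0 : ℝ)..Real.pi, Real.sin θ ^ (n - j + 1)) ≠ 0 :=
    fun j => (integral_sin_pow_pos _).ne'
  by_cases hμμ : μ = μ'
  · subst hμμ
    rw [if_pos rfl, if_pos rfl, solidAngle_eq, ← pow_add, ← two_mul, pow_mul]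
    have hprod : (∏ j : Fin (n + 1), ∫ θ in (0 : ℝ)..Real.pi, Real.sin θ ^ (n - j + 1)) *
        ∏ j : Fin (n + 1), ∑ i, w j i *
        (polarFactor (n - j) (μ.1 j) (lowerDegree μ j) (Real.arccos (x j i)) *
        polarFactor (n - j) (μ.1 j) (lowerDegree μ j) (Real.arccos (x j i))) = 1 := by
      rw [← Finset.prod_mul_distrib]
      exact Finset.prod_eq_one fun j _ => by rw [horth j rfl, if_pos rfl]
    rw [eq_div_iff (by
      exact mul_ne_zero (Finset.prod_ne_zero_iff.mpr fun j _ => hJ j) (by positivity))]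
    have hsign : ((-1 : ℝ) ^ 2) ^ μ.2.natAbs = 1 := by norm_num
    rw [hsign]
    generalize (∏ j : Fin (n + 1), ∑ i, w j i * _) = P at hprod ⊢
    field_simp
    linear_combination hprod
  · rw [if_neg hμμ]
    by_cases h2 : μ.2 = μ'.2
    -- At the last position where the multi-indices differ, the following indices agree, so the two
    -- polar factors share their lower index and are orthogonal. Factors at earlier angles need not
    -- be orthogonal.
    · have hex : ∃ j, lowerDegree μ j = lowerDegree μ' j ∧ μ.1 j ≠ μ'.1 j := by
        by_contra hcon
        push Not at hcon
        refine hμμ (Prod.ext (funext fun j => ?_) h2)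
        induction j using Fin.reverseInduction with
        | last => exact hcon _ (by rw [lowerDegree_last, lowerDegree_last, h2])
        | cast j ih => exact hcon _ (by rw [lowerDegree_castSucc, lowerDegree_castSucc, ih])
      obtain ⟨j, hj, hne⟩ := hex
      have h0 := horth j hj
      rw [if_neg hne] at h0
      rw [Finset.prod_eq_zero (Finset.mem_univ j) ((mul_eq_zero.mp h0).resolve_left (hJ j))]
      simp
    · rw [if_neg h2, mul_zero, mul_zero]

theorem infoMatrix_productDesign {n d r t : ℕ} (ht : 2 * d + 1 ≤ t)
    {x w : Fin (n + 1) → Fin r → ℝ}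
    (hquad : ∀ i : Fin (n + 1), IsQuadrature (polarWeight n i) (2 * d) (x i) (w i)) (β : ℝ) :
    infoMatrix (regressionFunctions n d) (productDesign x w β t) =
      (1 / solidAngle n) • (1 : Matrix (Row n d) (Row n d) ℝ) := by
  ext ⟨l, μ, hμ⟩ ⟨l', μ', hμ'⟩
  rw [infoMatrix, Matrix.of_apply, Matrix.smul_apply, Matrix.one_apply]
  simp only [regressionFunctions]
  rw [integral_hypersphericalHarmonic_mul ht hquad β (Nat.lt_succ_iff.mp l.isLt)
    (Nat.lt_succ_iff.mp l'.isLt) hμ hμ']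
  have : (⟨l, μ, hμ⟩ : Row n d) = ⟨l', μ', hμ'⟩ ↔ μ = μ' := by
    constructor
    · intro h
      exact congrArg (fun a : Row n d => a.2.1) h
    · rintro rfl
      have hll : l = l' := Fin.ext ((mem_levelSet.mp hμ).1.symm.trans (mem_levelSet.mp hμ').1)
      subst hll
      rfl
  simp only [this]
  split_ifs <;> simp

/-! ## Dimensions -/

theorem levelSet_level_zero (n : ℕ) : levelSet n 0 = {((fun _ => 0), 0)} := by
  ext μ
  rw [Finset.mem_singleton]
  constructor
  · intro h
    have h1 := le_of_mem_levelSet h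
    have h2 := abs_le_of_mem_levelSet h
    refine Prod.ext (funext fun j => Nat.le_zero.mp (h1 j)) ?_
    simpa using h2
  · rintro rfl
    exact mem_levelSet.mpr ⟨rfl, fun _ _ _ => le_rfl, by simp⟩

theorem continuous_regressionFunctions (n d : ℕ) (a : Row n d) :
    Continuous (regressionFunctions n d a) :=
  continuous_hypersphericalHarmonic _

section SumOfSquares

variable {n d r t : ℕ} {x w : Fin (n + 1) → Fin r → ℝ} {β : ℝ}

/-- The sum is constant, hence equal to its mean under the product design, where each harmonic
contributes `1/Ω`. -/
theorem sum_level_sq (ht : 2 * d + 1 ≤ t)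
    (hquad : ∀ i : Fin (n + 1), IsQuadrature (polarWeight n i) (2 * d) (x i) (w i))
    (hβ : β ∈ Set.Ioc (-(((t : ℝ) + 1) / t * Real.pi)) (-Real.pi)) {l : ℕ} (hl : l ≤ d)
    (y : (Fin (n + 1) → ℝ) × ℝ) :
    ∑ μ : Level n l, hypersphericalHarmonic μ.1 y ^ 2 =
      (levelSet n l).card * (1 / solidAngle n) := by
  obtain ⟨K, hK⟩ := exists_sum_levelSet_sq n
  have hξ := isDesign_productDesign (by omega : 0 < t) hquad hβ
  have hK' : ∀ y, ∑ μ : Level n l, hypersphericalHarmonic μ.1 y ^ 2 =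
      K * ((2 * l + n + 1) * (l + n).factorial / l.factorial) := by
    intro y
    rw [← hK l y, Finset.sum_coe_sort (levelSet n l) fun μ => hypersphericalHarmonic μ y ^ 2]
  have h := hξ.sum_diag_infoMatrix (isCompact_angleSpace n)
    (continuous_regressionFunctions n d)
    (e := fun μ : Level n l => (⟨⟨l, Nat.lt_succ_of_le hl⟩, μ⟩ : Row n d)) hK'
  rw [hK', ← h, infoMatrix_productDesign ht hquad β]
  simp

/-- The count is analytic: both the constant `K (2l+n+1)(l+n)!/l!` and `card/Ω` equal the sum of
squares. Level `0`, with its single harmonic, determines `K Ω`, and the quotient gives the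
cardinality. -/
theorem card_levelSet (ht : 2 * d + 1 ≤ t)
    (hquad : ∀ i : Fin (n + 1), IsQuadrature (polarWeight n i) (2 * d) (x i) (w i))
    (hβ : β ∈ Set.Ioc (-(((t : ℝ) + 1) / t * Real.pi)) (-Real.pi)) {l : ℕ} (hl : l ≤ d) :
    (levelSet n l).card = levelDim (n + 3) l := by
  obtain ⟨K, hK⟩ := exists_sum_levelSet_sq n
  have hΩ := solidAngle_pos n
  have h0 := sum_level_sq ht hquad hβ (Nat.zero_le d) 0
  have h1 := sum_level_sq ht hquad hβ hl 0
  rw [Finset.sum_coe_sort (levelSet n _) fun μ => hypersphericalHarmonic μ 0 ^ 2, hK] at h0 h1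
  rw [levelSet_level_zero] at h0
  have key : ((levelSet n l).card : ℝ) * (l.factorial * (n + 1).factorial) =
      (n + 1 + 2 * l) * (l + n).factorial := by
    rw [Nat.factorial_succ]
    simp only [Nat.cast_zero, Finset.card_singleton, zero_add, mul_zero, Nat.factorial_zero,
      Nat.cast_one, div_one, one_mul] at h0
    field_simp at h0 h1
    push_cast
    -- Level `0` reads `K Ω (n+1)! = 1`, so this factor cannot vanish.
    apply mul_left_cancel₀ (show K * solidAngle n ≠ 0 by
      intro h
      have : K * solidAngle n * ((n + 1) * n.factorial) = 1 := by linear_combination h0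
      rw [h, zero_mul] at this
      exact zero_ne_one this)
    linear_combination (levelSet n l).card * (l.factorial : ℝ) * h0 - h1
  have key' : (levelSet n l).card * (l.factorial * (n + 1).factorial) =
      (n + 1 + 2 * l) * (l + n).factorial := by exact_mod_cast key
  rw [levelDim, show n + 3 + 2 * l - 2 = n + 1 + 2 * l by omega, show l + (n + 3) - 3 = l + n by omega,
    show n + 3 - 2 = n + 1 by omega, ← key']
  exact (Nat.mul_div_cancel _ (by positivity)).symm

end SumOfSquares

/-- The row of `K` in which a given column has its entry `1`. -/
def columnRow {n d q : ℕ} {k : Fin (q + 1) → ℕ} (hkd : ∀ j, k j ≤ d) (b : Column n k) : Row n d :=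
  ⟨⟨k b.1, Nat.lt_succ_of_le (hkd b.1)⟩, b.2⟩

theorem columnRow_injective {n d q : ℕ} {k : Fin (q + 1) → ℕ} (hk : StrictMono k)
    (hkd : ∀ j, k j ≤ d) : Function.Injective (columnRow (n := n) hkd) := by
  rintro ⟨j, μ⟩ ⟨j', μ'⟩ h
  have h1 : j = j' := hk.injective (congrArg (fun a : Row n d => (a.1 : ℕ)) h)
  subst h1
  have h2 : μ = μ' := Subtype.ext (congrArg (fun a : Row n d => a.2.1) h)
  rw [h2]

theorem selectionMatrix_eq {n d q : ℕ} {k : Fin (q + 1) → ℕ} (hkd : ∀ j, k j ≤ d) :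
    selectionMatrix n d k = (1 : Matrix (Row n d) (Row n d) ℝ).submatrix id (columnRow hkd) := by
  ext ⟨⟨l, hl⟩, μ⟩ ⟨j, μ'⟩
  rw [selectionMatrix, Matrix.of_apply, Matrix.submatrix_apply, Matrix.one_apply]
  refine if_congr ?_ rfl rfl
  simp only [columnRow, id]
  constructor
  · rintro ⟨rfl, h⟩
    rw [Subtype.ext h]
  · intro h
    exact ⟨congrArg (fun a : Row n d => (a.1 : ℕ)) h, congrArg (fun a : Row n d => a.2.1) h⟩

end HypersphericalDesign

open HypersphericalDesign

theorem theorem3p2 (n d q r t : ℕ) (k : Fin (q + 1) → ℕ) (hk : StrictMono k)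
    (hkd : ∀ j, k j ≤ d) (ht : 2 * d + 1 ≤ t) (hr : r ∈ Finset.Icc (d + 1) (2 * d))
    (x w : Fin (n + 1) → Fin r → ℝ)
    (hquad : ∀ i : Fin (n + 1), IsQuadrature (polarWeight n i) (2 * d) (x i) (w i))
    (β : ℝ) (hβ : β ∈ Set.Ioc (-(((t : ℝ) + 1) / t * Real.pi)) (-Real.pi)) :
    infoMatrix (regressionFunctions n d) (productDesign x w β t) =
        (1 / solidAngle n) • (1 : Matrix (Row n d) (Row n d) ℝ) ∧
      (∀ p : WithBot ℝ, p < 1 →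
        IsPhiOptimal (angleSpace n) (regressionFunctions n d) (selectionMatrix n d k) p
          (productDesign x w β t)) ∧
      Fintype.card (Column n k) = ∑ j, levelDim (n + 3) (k j) ∧
      IsPhiEOptimal (angleSpace n) (regressionFunctions n d) (∑ j, levelDim (n + 3) (k j))
        (productDesign x w β t) := by
  have hM := infoMatrix_productDesign ht hquad β
  have hξ := isDesign_productDesign (by omega : 0 < t) hquad hβ
  have hS := isCompact_angleSpace n
  have hf := continuous_regressionFunctions n d
  have he := columnRow_injective (n := n) hk hkd
  have hΩ := solidAngle_pos n
  have hcardℓ : ∀ j, Fintype.card (Level n (k j)) = (levelSet n (k j)).card := fun j =>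
    Fintype.card_coe _
  have hcard : Fintype.card (Column n k) = ∑ j, levelDim (n + 3) (k j) := by
    rw [Fintype.card_sigma]
    exact Finset.sum_congr rfl fun j _ =>
      (hcardℓ j).trans (card_levelSet ht hquad hβ (hkd j))
  have hne : Nonempty (Column n k) :=
    ⟨⟨0, (fun _ => k 0, 0), mem_levelSet.mpr ⟨rfl, fun _ _ _ => le_rfl, by simp⟩⟩⟩
  have hsum : ∀ y, ∑ b, regressionFunctions n d (columnRow hkd b) y ^ 2 =
      Fintype.card (Column n k) * (1 / solidAngle n) := by
    intro y
    rw [Fintype.sum_sigma, Fintype.card_sigma, Nat.cast_sum, Finset.sum_mul]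
    refine Finset.sum_congr rfl fun j _ => ?_
    rw [hcardℓ j, ← sum_level_sq ht hquad hβ (hkd j) y]
    rfl
  refine ⟨hM, fun p hp => ?_, hcard, ?_⟩
  · rw [selectionMatrix_eq hkd]
    exact isPhiOptimal_of_infoMatrix_eq_smul_one hS hf he (by positivity) hsum hξ hM hp
  · rw [← hcard]
    exact isPhiEOptimal_of_infoMatrix_eq_smul_one hS hf he hsum hξ hM
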